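/- **Setting.** Let $n\ge 2$, let $x_1,\dots,x_n$ be distinct points of a set $\mathcal X\subseteq\mathbb R^d$, let $\Theta_\rho\subseteq\mathbb R^q$, and let $r(x,x',\theta_\rho)$ be a parametric correlation function: for every $\theta_\rho\in\Theta_\rho$ one has $r(x,x,\theta_\rho)=1$ on $\mathcal X$, and all matrices $(r(z_i,z_j,\theta_\rho))_{ij}$ with $z_1,\dots,z_m\in\mathcal X$ are symmetric positive semidefinite. Put $\mathbf r(\theta_\rho)=(r(x_i,x_j,\theta_\rho))_{i,j}\in\mathbb R^{n^2}$. Let $\theta^*=(\theta^*_\rho,\theta^*_v)$ with $\theta_\rho^*\in\operatorname{int}\Theta_\rho$ and $\theta_v^*>0$ be the true parameters (there is no nugget), let $C^*=(\theta_v^*\,r(x_i,x_j,\theta_\rho^*))_{ij}$ be positive definite, $P^*=(C^*)^{-1}$, and let $0<a^*\le b^*<\infty$ satisfy $a^*I\preceq P^*\preceq b^*I$. All vector norms are Euclidean. **The two-stage SPS estimate.** Let $y^{(1)},\dots,y^{(N)}$ be independent $\mathcal N(0,C^*)$ vectors (independent realizations, observed at $x_1,\dots,x_n$, of the zero-mean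 Gaussian random field with covariance function $\theta_v^*r(\cdot,\cdot,\theta_\rho^*)$), let $S=\frac1N\sum_s y^{(s)}y^{(s)\top}$, and let $G_{ij}=\|x_i-x_j\|$ for $i\ne j$ and $G_{ii}=\min_{j\neq i}\|x_i-x_j\|$. Stage I: for $\alpha>0$, $$\hat P\in\arg\min\Big\{\operatorname{Tr}(SP)-\log\det P+\alpha\sum_{i,j}G_{ij}|P_{ij}|\ :\ a^*I\preceq P\preceq b^*I\Big\}.$$ Stage II: let $\hat{\mathbf c}\in\mathbb R^{n^2}$ be the vector of the entries of $\hat P^{-1}$, and for $\mathbf c\in\mathbb R^{n^2}$ put $v(\theta_\rho;\mathbf c)=\max\{0,\mathbf r(\theta_\rho)^\top\mathbf c/\|\mathbf r(\theta_\rho)\|^2\}$ and $f(\theta_\rho;\mathbf c)=\frac12\|v(\theta_\rho;\mathbf c)\,\mathbf r(\theta_\rho)-\mathbf c\|^2$. Then $\hat\theta=(\hat\theta_\rho,\hat\theta_v)$ with $\hat\theta_\rho\in\arg\min_{\Theta_\rho}f(\cdot;\hat{\mathbf c})$ and $\hat\theta_v=v(\hat\theta_\rho;\hat{\mathbf c})$.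 **Theorem.** Suppose that $\mathbf r$ is twice continuously differentiable on $\operatorname{int}\Theta_\rho$, that $\mathbf r(\theta^*_\rho),\partial_1\mathbf r(\theta^*_\rho),\dots,\partial_q\mathbf r(\theta^*_\rho)$ are linearly independent, and that $\theta_\rho^*$ is identifiable in $\Theta_\rho$: for every $\delta>0$ there is $\eta>0$ such that $\theta_\rho\in\Theta_\rho$ and $\|\mathbf r(\theta_\rho)-\mathbf r(\theta_\rho^*)\|\le\eta$ imply $\|\theta_\rho-\theta_\rho^*\|\le\delta$. Then there are constants $K,m,\delta>0$, which depend on neither $M$ nor $\varepsilon$, such that the following holds for all $M>0$ and $\varepsilon>0$. Let $N_0=\lceil 2(M\ln n+\ln 4)\rceil$. There is an integer $N\ge N_0$ with $N\le K N_0\max\{1,\varepsilon^{-2}\}$ (so $N=O(N_0/\varepsilon^2)$ as $\varepsilon\to0$) such that, for $\alpha=40\,\theta_v^*\sqrt{N_0/N}$, with probability at least $1-n^{-M}$ a two-stage SPS estimate exists, every such estimate satisfies $\|\hat\theta-\theta^*\|\le\varepsilon$, and the Stage-II objective $f(\cdot;\hat{\mathbf c})$ is strongly convex around $\hat\theta_\rho$,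 namely with modulus $m$ on the ball of radius $\delta$ about $\hat\theta_\rho$. -/

import Mathlib

open MeasureTheory ProbabilityTheory

noncomputable section

namespace SPS

/-- Euclidean space `ℝᵏ`. -/
abbrev E (k : ℕ) := EuclideanSpace ℝ (Fin k)

/-- The long vectors in `ℝ^{n²}`, indexed by pairs, with the Euclidean norm. -/
abbrev LongVec (n : ℕ) := EuclideanSpace ℝ (Fin n × Fin n)

/-- Parameter vectors `θ = (θ_ρ, θ_v) ∈ ℝ^{q+1}` (no nugget), with the Euclidean norm. -/
abbrev Param (q : ℕ) := WithLp 2 (E q × ℝ)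

/-- `k` is a correlation function on `X`: it has unit diagonal, and all the matrices that it
forms on finitely many points of `X` are symmetric and positive semidefinite. -/
def IsCorrelationFunction {d : ℕ} (X : Set (E d)) (k : E d → E d → ℝ) : Prop :=
  (∀ z ∈ X, k z z = 1) ∧
    ∀ (m : ℕ) (z : Fin m → E d), (∀ i, z i ∈ X) →
      (Matrix.of fun i j => k (z i) (z j)).PosSemidef

section Model

variable {d q n : ℕ} (k : E d → E d → E q → ℝ) (x : Fin n → E d)

/-- The covariance matrix `C(θ) = (θ_v k(x_i, x_j, θ_ρ))_{ij}` at the locations `x`. -/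
def covMatrix (θ : Param q) : Matrix (Fin n) (Fin n) ℝ :=
  Matrix.of fun i j => θ.snd * k (x i) (x j) θ.fst

/-- The correlation vector `r(θ_ρ) = (k(x_i, x_j, θ_ρ))_{ij} ∈ ℝ^{n²}`. -/
def corrVec (θρ : E q) : LongVec n :=
  WithLp.toLp 2 fun p => k (x p.1) (x p.2) θρ

/-- A matrix as a long vector. -/
def longVec (C : Matrix (Fin n) (Fin n) ℝ) : LongVec n :=
  WithLp.toLp 2 fun p => C p.1 p.2

/-- The distance weights: `G_ij = ‖x_i - x_j‖` for `i ≠ j`, and `G_ii` is the distance from `x_i`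
to the nearest other location. -/
def weight : Matrix (Fin n) (Fin n) ℝ :=
  Matrix.of fun i j => if i = j then ⨅ l : {l : Fin n // l ≠ i}, ‖x i - x l‖ else ‖x i - x j‖

/-- The sample covariance matrix `S = (1/N) ∑_r y⁽ʳ⁾ (y⁽ʳ⁾)ᵀ` of (centered) data. -/
def sampleCov {N : ℕ} (y : Fin N → E n) : Matrix (Fin n) (Fin n) ℝ :=
  Matrix.of fun i j => (1 / (N : ℝ)) * ∑ s, y s i * y s j

/-- The objective `⟨S, P⟩ - log det P + α ⟨G, |P|⟩` of the first stage. -/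
def stageOneObj (S G : Matrix (Fin n) (Fin n) ℝ) (α : ℝ) (P : Matrix (Fin n) (Fin n) ℝ) : ℝ :=
  (S.transpose * P).trace - Real.log P.det + α * ∑ i, ∑ j, G i j * |P i j|

/-- The spectral box `a I ⪯ P ⪯ b I` in the symmetric matrices. -/
def spectralBox (n : ℕ) (a b : ℝ) : Set (Matrix (Fin n) (Fin n) ℝ) :=
  {P | (P - a • (1 : Matrix (Fin n) (Fin n) ℝ)).PosSemidef ∧
    (b • (1 : Matrix (Fin n) (Fin n) ℝ) - P).PosSemidef}

/-- `P` solves the first stage: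
`P ∈ argmin {⟨S, P⟩ - log det P + α ⟨G, |P|⟩ : a I ⪯ P ⪯ b I}`. -/
def IsStageOne (a b α : ℝ) (S P : Matrix (Fin n) (Fin n) ℝ) : Prop :=
  P ∈ spectralBox n a b ∧ IsMinOn (stageOneObj S (weight x) α) (spectralBox n a b) P

/-- The variance parameter `max {0, r(θ_ρ)ᵀ c / ‖r(θ_ρ)‖²}` fitted to `c` for given `θ_ρ`. -/
def fitVar (c : LongVec n) (θρ : E q) : ℝ :=
  max 0 (inner ℝ (corrVec k x θρ) c / ‖corrVec k x θρ‖ ^ 2)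

/-- The objective `f(θ_ρ; c)` of the second stage. -/
def stageTwoObj (c : LongVec n) (θρ : E q) : ℝ :=
  1 / 2 * ‖fitVar k x c θρ • corrVec k x θρ - c‖ ^ 2

/-- `θ` solves the second stage for `c`: `θ_ρ ∈ argmin_{Θ_ρ} f(·; c)`, and `θ_v` is the fitted
variance parameter. -/
def IsStageTwo (Θρ : Set (E q)) (c : LongVec n) (θ : Param q) : Prop :=
  θ.fst ∈ Θρ ∧ IsMinOn (stageTwoObj k x c) Θρ θ.fst ∧ θ.snd = fitVar k x c θ.fst

/-- The spatial parameter `θ_ρ` is identifiable within `Θ_ρ` from the correlation vector: parameters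
in `Θ_ρ` whose correlation vectors approach `r(θ_ρ)` have to approach `θ_ρ`. -/
def IdentifiableAt (Θρ : Set (E q)) (θρ : E q) : Prop :=
  ∀ δ > 0, ∃ η > 0, ∀ t ∈ Θρ, ‖corrVec k x t - corrVec k x θρ‖ ≤ η → ‖t - θρ‖ ≤ δ

end Model

/-- `N₀ = ⌈2 (M ln n + ln 4)⌉`. -/
def sampleBase (n : ℕ) (M : ℝ) : ℕ :=
  ⌈2 * (M * Real.log n + Real.log 4)⌉₊

/-- `y⁽¹⁾, …, y⁽ᴺ⁾` are independent realizations of the zero-mean Gaussian random field with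
covariance function `θ_v k(·, ·, θ_ρ)`, observed at the locations `x`. -/
def IsGRFSample {d q n N : ℕ} (k : E d → E d → E q → ℝ) (x : Fin n → E d) (θ : Param q)
    {Ω : Type*} [MeasurableSpace Ω] (μ : Measure Ω) (y : Fin N → Ω → E n) : Prop :=
  iIndepFun y μ ∧ ∀ s, HasLaw (y s) (multivariateGaussian 0 (covMatrix k x θ)) μ

end SPS

end

/-!
Stage I. On the spectral box, `Tr (C P) - log det P` exceeds its minimum over the positive definite
matrices, attained at `C⁻¹`, by at least a multiple of `‖P - C⁻¹‖²`. Comparing the penalized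
objective at its minimizer and at `C⁻¹` bounds this excess by a multiple of
`(‖S - C‖ + α) ‖P - C⁻¹‖`. Hence `‖P - C⁻¹‖`, and with it `‖P⁻¹ - C‖`, is `O(‖S - C‖ + α)`.

Stage II. The objective is half the squared distance from `c` to the ray spanned by `r(θ_ρ)`. The
unit diagonal provides a linear functional equal to `1` on every `r(θ_ρ)`, so if the ray of `r(θ_ρ)`
is as close to `c` as the true one, then `r(θ_ρ)` and the fitted variance are within `O(‖c - c*‖)`
of the truth. Identifiability then localizes `θ_ρ`, and injectivity of the derivative of `r` turns
this into `‖θ_ρ - θ_ρ*‖ = O(‖c - c*‖)`. At the truth the residual vanishes, and its derivative in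
direction `h` is `θ_v*` times the component of `D r h` orthogonal to `r`, which is injective in `h`
by linear independence. Near the truth this dominates the curvature of the residual, so that half
the squared norm of the residual is strongly convex.

Concentration. The entries of `y yᵀ` have exponential moments, so by Chernoff's bound
`‖S - C‖ = O(√(N₀ / N))` outside an event of probability at most `n^(-M)`. Hence `‖S - C‖ + α` is
below a prescribed multiple of `min 1 ε` as soon as `N` is a large multiple of `N₀ max(1, ε⁻²)`.
-/

namespace SPS

section Matrix

open Matrix
open scoped Matrix.Norms.Frobenius

variable {m : Type*} [Fintype m]

theorem frobenius_norm_sq (A : Matrix m m ℝ) : ‖A‖ ^ 2 = ∑ i, ∑ j, A i j ^ 2 := by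
  rw [frobenius_norm_def, ← Real.sqrt_eq_rpow, Real.sq_sqrt (by positivity)]
  simp

theorem frobenius_norm_sq_eq_trace (A : Matrix m m ℝ) : ‖A‖ ^ 2 = (Aᵀ * A).trace := by
  rw [frobenius_norm_sq, Finset.sum_comm]
  simp [trace, mul_apply, sq]

theorem abs_apply_le_frobenius_norm (A : Matrix m m ℝ) (i j : m) : |A i j| ≤ ‖A‖ := by
  refine abs_le_of_sq_le_sq ?_ (norm_nonneg A)
  rw [frobenius_norm_sq]
  calc A i j ^ 2 ≤ ∑ j, A i j ^ 2 :=
        Finset.single_le_sum (fun j _ => sq_nonneg (A i j)) (Finset.mem_univ j)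
    _ ≤ ∑ i, ∑ j, A i j ^ 2 :=
        Finset.single_le_sum (f := fun i => ∑ j, A i j ^ 2) (fun i _ => by positivity)
          (Finset.mem_univ i)

theorem frobenius_norm_le_of_abs_apply_le {A : Matrix m m ℝ} {t : ℝ} (ht : 0 ≤ t)
    (h : ∀ i j, |A i j| ≤ t) : ‖A‖ ≤ Fintype.card m * t := by
  refine le_of_sq_le_sq ?_ (by positivity)
  rw [frobenius_norm_sq]
  calc ∑ i, ∑ j, A i j ^ 2 ≤ ∑ _i : m, ∑ _j : m, t ^ 2 :=
        Finset.sum_le_sum fun i _ => Finset.sum_le_sum fun j _ => sq_le_sq' (abs_le.1 (h i j)).1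
          (abs_le.1 (h i j)).2
    _ = (Fintype.card m * t) ^ 2 := by simp; ring

theorem abs_trace_transpose_mul_le (A B : Matrix m m ℝ) : |(Aᵀ * B).trace| ≤ ‖A‖ * ‖B‖ := by
  refine abs_le_of_sq_le_sq ?_ (by positivity)
  have htrace : (Aᵀ * B).trace = ∑ p : m × m, A p.1 p.2 * B p.1 p.2 := by
    rw [Fintype.sum_prod_type, Finset.sum_comm]
    simp [trace, mul_apply]
  rw [mul_pow, frobenius_norm_sq, frobenius_norm_sq, htrace, ← Fintype.sum_prod_type',
    ← Fintype.sum_prod_type']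
  exact Finset.sum_mul_sq_le_sq_mul_sq _ _ _

theorem sum_mul_abs_sub_sum_mul_abs_le (G A B : Matrix m m ℝ) :
    ∑ i, ∑ j, G i j * |A i j| - ∑ i, ∑ j, G i j * |B i j| ≤ (∑ i, ∑ j, |G i j|) * ‖A - B‖ := by
  simp only [← Finset.sum_sub_distrib, Finset.sum_mul, ← mul_sub]
  refine Finset.sum_le_sum fun i _ => Finset.sum_le_sum fun j _ => ?_
  calc G i j * (|A i j| - |B i j|) ≤ |G i j| * |(|A i j| - |B i j|)| := by
        rw [← abs_mul]; exact le_abs_self _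
    _ ≤ |G i j| * ‖A - B‖ := by
        gcongr
        exact (abs_abs_sub_abs_le_abs_sub _ _).trans (abs_apply_le_frobenius_norm (A - B) i j)

variable [DecidableEq m]

theorem frobenius_norm_sub_one_sq {A : Matrix m m ℝ} (hA : A.IsHermitian) :
    ‖A - 1‖ ^ 2 = ∑ i, (hA.eigenvalues i - 1) ^ 2 := by
  have hT : Aᵀ = A := by simpa [IsHermitian] using hA
  have trace_eq : A.trace = ∑ i, hA.eigenvalues i := by simpa using hA.trace_eq_sum_eigenvalues
  have trace_mul_self_eq : (A * A).trace = ∑ i, hA.eigenvalues i ^ 2 := by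
    conv_lhs => rw [hA.spectral_theorem, ← map_mul, Unitary.conjStarAlgAut_apply,
      trace_mul_cycle, Unitary.coe_star_mul_self, one_mul, diagonal_mul_diagonal]
    simp [trace_diagonal, sq]
  calc ‖A - 1‖ ^ 2 = (A * A).trace - 2 * A.trace + Fintype.card m := by
        rw [frobenius_norm_sq_eq_trace, transpose_sub, hT, transpose_one, sub_mul, mul_sub,
          mul_one, one_mul]
        simp only [trace_sub, trace_one]
        ring
    _ = ∑ i, (hA.eigenvalues i - 1) ^ 2 := by
        rw [trace_eq, trace_mul_self_eq]
        simp [sub_sq, Finset.sum_add_distrib, Finset.sum_sub_distrib, Finset.mul_sum]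

theorem sq_sub_one_le_sub_one_sub_log {B t : ℝ} (ht : 0 < t) (htB : t ≤ B) :
    1 / (2 * (B + 1)) * (t - 1) ^ 2 ≤ t - 1 - Real.log t := by
  have hsq : √t ^ 2 = t := Real.sq_sqrt ht.le
  have hlog : Real.log t ≤ 2 * (√t - 1) := by
    have := Real.log_le_sub_one_of_pos (Real.sqrt_pos.2 ht)
    rw [Real.log_sqrt ht.le] at this
    linarith
  have hcoef : (√t + 1) ^ 2 ≤ 2 * (B + 1) := by nlinarith [sq_nonneg (√t - 1)]
  calc 1 / (2 * (B + 1)) * (t - 1) ^ 2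
      = 1 / (2 * (B + 1)) * ((√t + 1) ^ 2 * (√t - 1) ^ 2) := by
        congr 1
        linear_combination (-(√t ^ 2 + t - 2)) * hsq
    _ ≤ (√t - 1) ^ 2 := by
        rw [one_div, inv_mul_le_iff₀ (by linarith)]
        gcongr
    _ ≤ t - 1 - Real.log t := by linarith [hsq]

/-- Stein's loss of `P` as an estimate of `C⁻¹`: the Bregman divergence of `-log det` between
`P` and `C⁻¹`. -/
noncomputable def steinLoss (C P : Matrix m m ℝ) : ℝ :=
  (C * P).trace - Real.log (C * P).det - Fintype.card m

theorem le_steinLoss_one {H : Matrix m m ℝ} (hH : H.PosDef) {B : ℝ} (hB : H.trace ≤ B) :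
    1 / (2 * (B + 1)) * ‖H - 1‖ ^ 2 ≤ steinLoss 1 H := by
  have hpos := hH.eigenvalues_pos
  have trace_eq : H.trace = ∑ i, hH.1.eigenvalues i := by
    simpa using hH.1.trace_eq_sum_eigenvalues
  have log_det_eq : Real.log H.det = ∑ i, Real.log (hH.1.eigenvalues i) := by
    rw [← Real.log_prod fun i _ => (hpos i).ne']
    simpa using congrArg Real.log hH.1.det_eq_prod_eigenvalues
  have hle : ∀ i, hH.1.eigenvalues i ≤ B := fun i =>
    (Finset.single_le_sum (fun j _ => (hpos j).le) (Finset.mem_univ i)).trans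
      (trace_eq ▸ hB)
  calc 1 / (2 * (B + 1)) * ‖H - 1‖ ^ 2
      = ∑ i, 1 / (2 * (B + 1)) * (hH.1.eigenvalues i - 1) ^ 2 := by
        rw [frobenius_norm_sub_one_sq hH.1, Finset.mul_sum]
    _ ≤ ∑ i, (hH.1.eigenvalues i - 1 - Real.log (hH.1.eigenvalues i)) :=
        Finset.sum_le_sum fun i _ => sq_sub_one_le_sub_one_sub_log (hpos i) (hle i)
    _ = steinLoss 1 H := by
        rw [steinLoss, one_mul, trace_eq, log_det_eq]
        simp only [Finset.sum_sub_distrib, Finset.sum_const, Finset.card_univ, nsmul_eq_mul,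
          mul_one]
        ring

theorem steinLoss_transpose_mul (F P : Matrix m m ℝ) :
    steinLoss (Fᵀ * F) P = steinLoss 1 (F * P * Fᵀ) := by
  rw [steinLoss, steinLoss, one_mul, trace_mul_comm (F * P), det_mul_comm (F * P), ← mul_assoc]

theorem exists_posDef_eq_transpose_mul {C : Matrix m m ℝ} (hC : C.PosDef) :
    ∃ F : Matrix m m ℝ, IsUnit F ∧ C = Fᵀ * F := by
  obtain ⟨F, hF⟩ : ∃ F : Matrix m m ℝ, C = Fᴴ * F := by
    open scoped MatrixOrder in
    exact CStarAlgebra.nonneg_iff_eq_star_mul_self.1 hC.posSemidef.nonneg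
  exact ⟨F, isUnit_of_mul_isUnit_right (hF ▸ hC.isUnit),
    by rwa [conjTranspose_eq_transpose_of_trivial] at hF⟩

theorem exists_mul_norm_sub_inv_sq_le_steinLoss {C : Matrix m m ℝ} (hC : C.PosDef) (B : ℝ) :
    ∃ κ > 0, ∀ P : Matrix m m ℝ, P.PosDef → (C * P).trace ≤ B →
      κ * ‖P - C⁻¹‖ ^ 2 ≤ steinLoss C P := by
  obtain ⟨F, hF, rfl⟩ := exists_posDef_eq_transpose_mul hC
  have hFdet : IsUnit F.det := (isUnit_iff_isUnit_det F).1 hF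
  set B' := max B 0
  set W := ‖F⁻¹‖ * ‖Fᵀ⁻¹‖
  refine ⟨1 / (2 * (B' + 1)) * (1 / (W ^ 2 + 1)), by positivity, fun P hP hB => ?_⟩
  have hH : (F * P * Fᵀ).PosDef := by
    simpa [conjTranspose_eq_transpose_of_trivial] using
      hP.mul_mul_conjTranspose_same (vecMul_injective_iff_isUnit.2 hF)
  have htrace : (F * P * Fᵀ).trace ≤ B' := by
    rw [trace_mul_comm, ← mul_assoc]
    exact hB.trans (le_max_left _ _)
  have hsub : P - (Fᵀ * F)⁻¹ = F⁻¹ * (F * P * Fᵀ - 1) * Fᵀ⁻¹ := by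
    rw [mul_sub, sub_mul, mul_one, mul_assoc F, ← mul_assoc, ← mul_assoc,
      nonsing_inv_mul _ hFdet, one_mul, mul_assoc, mul_nonsing_inv _ (by rwa [det_transpose]),
      mul_one, Matrix.mul_inv_rev]
  have hnorm : ‖P - (Fᵀ * F)⁻¹‖ ≤ W * ‖F * P * Fᵀ - 1‖ := by
    rw [hsub]
    calc ‖F⁻¹ * (F * P * Fᵀ - 1) * Fᵀ⁻¹‖ ≤ ‖F⁻¹‖ * ‖F * P * Fᵀ - 1‖ * ‖Fᵀ⁻¹‖ :=
          (norm_mul_le _ _).trans (by gcongr; exact norm_mul_le _ _)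
      _ = W * ‖F * P * Fᵀ - 1‖ := by ring
  calc 1 / (2 * (B' + 1)) * (1 / (W ^ 2 + 1)) * ‖P - (Fᵀ * F)⁻¹‖ ^ 2
      ≤ 1 / (2 * (B' + 1)) * (1 / (W ^ 2 + 1) * (W * ‖F * P * Fᵀ - 1‖) ^ 2) := by
        rw [mul_assoc]
        gcongr
    _ ≤ 1 / (2 * (B' + 1)) * ‖F * P * Fᵀ - 1‖ ^ 2 := by
        gcongr
        rw [one_div, inv_mul_le_iff₀ (by positivity)]
        nlinarith [sq_nonneg ‖F * P * Fᵀ - 1‖]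
    _ ≤ steinLoss 1 (F * P * Fᵀ) := le_steinLoss_one hH htrace
    _ = steinLoss (Fᵀ * F) P := (steinLoss_transpose_mul F P).symm

end Matrix

section SpectralBox

open Matrix

variable {n : ℕ} {a b : ℝ} {P : Matrix (Fin n) (Fin n) ℝ}

theorem posDef_of_mem_spectralBox (ha : 0 < a) (hP : P ∈ spectralBox n a b) : P.PosDef := by
  simpa using (PosDef.one.smul ha).add_posSemidef hP.1

theorem isClosed_posSemidef {m : Type*} [Finite m] :
    IsClosed {P : Matrix m m ℝ | P.PosSemidef} := by
  have := Fintype.ofFinite m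
  simp only [posSemidef_iff_dotProduct_mulVec, Set.ofPred_and, IsHermitian, Set.ofPred_forall]
  exact (isClosed_eq (by fun_prop) (by fun_prop)).inter
    (isClosed_iInter fun v => isClosed_le continuous_const (by fun_prop))

theorem isClosed_spectralBox : IsClosed (spectralBox n a b) :=
  (isClosed_posSemidef.preimage (f := fun P => P - a • (1 : Matrix (Fin n) (Fin n) ℝ))
    (by fun_prop)).inter
  (isClosed_posSemidef.preimage (f := fun P => b • (1 : Matrix (Fin n) (Fin n) ℝ) - P)
    (by fun_prop))

theorem two_mul_abs_apply_le_add_diag {m : Type*} [Finite m] {P : Matrix m m ℝ}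
    (hP : P.PosSemidef) (i j : m) : 2 * |P i j| ≤ P i i + P j j := by
  classical
  have := Fintype.ofFinite m
  have hsymm : P j i = P i j := by simpa using hP.1.apply i j
  have hadd := hP.dotProduct_mulVec_nonneg (Pi.single i 1 + Pi.single j 1)
  have hsub := hP.dotProduct_mulVec_nonneg (Pi.single i 1 - Pi.single j 1)
  simp only [star_trivial, mulVec_add, mulVec_sub, mulVec_single_one, dotProduct_add,
    dotProduct_sub, add_dotProduct, sub_dotProduct, single_one_dotProduct, col_apply, hsymm]
    at hadd hsub
  rcases abs_cases (P i j) with h | h <;> linarith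

theorem abs_apply_le_of_mem_spectralBox (ha : 0 < a) (hP : P ∈ spectralBox n a b) (i j : Fin n) :
    |P i j| ≤ b := by
  have hdiag : ∀ l, P l l ≤ b := fun l => by simpa using hP.2.diag_nonneg (i := l)
  linarith [two_mul_abs_apply_le_add_diag (posDef_of_mem_spectralBox ha hP).posSemidef i j,
    hdiag i, hdiag j]

theorem isCompact_spectralBox (ha : 0 < a) : IsCompact (spectralBox n a b) := by
  have hcube : IsCompact
      (Set.univ.pi fun _ : Fin n => Set.univ.pi fun _ : Fin n => Set.Icc (-b) b) :=
    isCompact_univ_pi fun _ => isCompact_univ_pi fun _ => isCompact_Icc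
  exact hcube.of_isClosed_subset isClosed_spectralBox fun P hP i _ j _ =>
    abs_le.1 (abs_apply_le_of_mem_spectralBox ha hP i j)

theorem continuousOn_inv_spectralBox (ha : 0 < a) :
    ContinuousOn (fun P : Matrix (Fin n) (Fin n) ℝ => P⁻¹) (spectralBox n a b) := by
  simp only [Matrix.inv_def, Ring.inverse_eq_inv']
  exact (ContinuousOn.inv₀ (by fun_prop) fun P hP =>
    (posDef_of_mem_spectralBox ha hP).det_pos.ne').smul (by fun_prop)

theorem exists_isStageOne {d : ℕ} (x : Fin n → E d) (ha : 0 < a)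
    (hne : (spectralBox n a b).Nonempty) (α : ℝ) (S : Matrix (Fin n) (Fin n) ℝ) :
    ∃ P, IsStageOne x a b α S P := by
  refine (isCompact_spectralBox ha).exists_isMinOn hne ?_
  unfold stageOneObj
  exact ((by fun_prop : Continuous _).continuousOn.sub (ContinuousOn.log (by fun_prop) fun P hP =>
    (posDef_of_mem_spectralBox ha hP).det_pos.ne')).add (by fun_prop)

end SpectralBox

section StageOne

open Matrix
open scoped Matrix.Norms.Frobenius

variable {n : ℕ} {C : Matrix (Fin n) (Fin n) ℝ}

theorem stageOneObj_sub_stageOneObj_inv (hC : C.PosDef) (S G : Matrix (Fin n) (Fin n) ℝ) (α : ℝ)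
    {P : Matrix (Fin n) (Fin n) ℝ} (hP : P.det ≠ 0) :
    stageOneObj S G α P - stageOneObj S G α C⁻¹ =
      steinLoss C P + ((S - C)ᵀ * (P - C⁻¹)).trace +
        α * (∑ i, ∑ j, G i j * |P i j| - ∑ i, ∑ j, G i j * |C⁻¹ i j|) := by
  have hCT : Cᵀ = C := by simpa [conjTranspose_eq_transpose_of_trivial] using hC.1.eq
  have hlog : Real.log C⁻¹.det = -Real.log C.det := by
    rw [det_nonsing_inv, Ring.inverse_eq_inv', Real.log_inv]
  have htrace : ((S - C)ᵀ * (P - C⁻¹)).trace =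
      (Sᵀ * P).trace - (Sᵀ * C⁻¹).trace - (C * P).trace + n := by
    rw [transpose_sub, hCT, sub_mul, mul_sub, mul_sub, mul_nonsing_inv _ hC.det_pos.ne'.isUnit]
    simp only [trace_sub, trace_one, Fintype.card_fin]
    ring
  rw [stageOneObj, stageOneObj, steinLoss, htrace, hlog, det_mul,
    Real.log_mul hC.det_pos.ne' hP, Fintype.card_fin]
  ring

theorem exists_norm_sub_inv_le_of_stageOneObj_le (hC : C.PosDef) (G : Matrix (Fin n) (Fin n) ℝ)
    (B : ℝ) :
    ∃ L > 0, ∀ (S : Matrix (Fin n) (Fin n) ℝ) (α : ℝ) (P : Matrix (Fin n) (Fin n) ℝ), 0 ≤ α →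
      P.PosDef → (C * P).trace ≤ B → stageOneObj S G α P ≤ stageOneObj S G α C⁻¹ →
      ‖P - C⁻¹‖ ≤ L * (‖S - C‖ + α) := by
  obtain ⟨κ, hκ, hconv⟩ := exists_mul_norm_sub_inv_sq_le_steinLoss hC B
  set g := ∑ i, ∑ j, |G i j|
  have hg : 0 ≤ g := by positivity
  refine ⟨(1 + g) / κ, by positivity, fun S α P hα hP hB hle => ?_⟩
  have hbasic : κ * ‖P - C⁻¹‖ * ‖P - C⁻¹‖ ≤ (‖S - C‖ + α * g) * ‖P - C⁻¹‖ := by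
    have hpen := sum_mul_abs_sub_sum_mul_abs_le G C⁻¹ P
    rw [norm_sub_rev] at hpen
    linarith [hconv P hP hB, stageOneObj_sub_stageOneObj_inv hC S G α hP.det_pos.ne',
      neg_le_of_abs_le (abs_trace_transpose_mul_le (S - C) (P - C⁻¹)),
      mul_le_mul_of_nonneg_left hpen hα]
  have hlin : κ * ‖P - C⁻¹‖ ≤ ‖S - C‖ + α * g := by
    rcases (norm_nonneg (P - C⁻¹)).eq_or_lt with h | h
    · rw [← h, mul_zero]; positivity
    · exact le_of_mul_le_mul_right hbasic h
  rw [div_mul_eq_mul_div, le_div_iff₀' hκ]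
  nlinarith [mul_nonneg hg (norm_nonneg (S - C))]

theorem norm_longVec (A : Matrix (Fin n) (Fin n) ℝ) : ‖longVec A‖ = ‖A‖ := by
  rw [← sq_eq_sq₀ (norm_nonneg _) (norm_nonneg _), frobenius_norm_sq,
    EuclideanSpace.real_norm_sq_eq, Fintype.sum_prod_type]
  rfl

theorem longVec_sub (A B : Matrix (Fin n) (Fin n) ℝ) :
    longVec (A - B) = longVec A - longVec B := rfl

theorem exists_norm_longVec_inv_sub_le {d : ℕ} (x : Fin n → E d) (hC : C.PosDef) {a b : ℝ}
    (ha : 0 < a) (hmem : C⁻¹ ∈ spectralBox n a b) :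
    ∃ L > 0, ∀ (S : Matrix (Fin n) (Fin n) ℝ) (α : ℝ) (P : Matrix (Fin n) (Fin n) ℝ), 0 ≤ α →
      IsStageOne x a b α S P → ‖longVec P⁻¹ - longVec C‖ ≤ L * (‖S - C‖ + α) := by
  have hbox := isCompact_spectralBox (n := n) (b := b) ha
  obtain ⟨B, hB⟩ := hbox.exists_bound_of_continuousOn (f := fun P => (C * P).trace) (by fun_prop)
  obtain ⟨B', hB'⟩ := hbox.exists_bound_of_continuousOn (continuousOn_inv_spectralBox ha)
  obtain ⟨L, hL, hrate⟩ := exists_norm_sub_inv_le_of_stageOneObj_le hC (weight x) B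
  refine ⟨(|B'| * ‖C‖ + 1) * L, by positivity, fun S α P hα hP => ?_⟩
  have hPpos := posDef_of_mem_spectralBox ha hP.1
  have hsub : P⁻¹ - C = P⁻¹ * (C⁻¹ - P) * C := by
    rw [mul_sub, sub_mul, nonsing_inv_mul _ hPpos.det_pos.ne'.isUnit, one_mul, mul_assoc,
      nonsing_inv_mul _ hC.det_pos.ne'.isUnit, mul_one]
  rw [← longVec_sub, norm_longVec, hsub]
  calc ‖P⁻¹ * (C⁻¹ - P) * C‖ ≤ ‖P⁻¹‖ * ‖C⁻¹ - P‖ * ‖C‖ :=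
        (norm_mul_le _ _).trans (by gcongr; exact norm_mul_le _ _)
    _ ≤ |B'| * ‖P - C⁻¹‖ * ‖C‖ := by
        rw [norm_sub_rev C⁻¹]
        gcongr
        exact (hB' P hP.1).trans (le_abs_self _)
    _ ≤ (|B'| * ‖C‖ + 1) * ‖P - C⁻¹‖ := by linarith [norm_nonneg (P - C⁻¹)]
    _ ≤ (|B'| * ‖C‖ + 1) * (L * (‖S - C‖ + α)) := by
        gcongr
        exact hrate S α P hα hPpos ((le_abs_self _).trans (hB P hP.1)) (hP.2 hmem)
    _ = (|B'| * ‖C‖ + 1) * L * (‖S - C‖ + α) := by ring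

end StageOne

section StrongConvexity

open Filter Topology

variable {V W F : Type*} [NormedAddCommGroup V] [NormedSpace ℝ V]
  [NormedAddCommGroup W] [NormedSpace ℝ W]

theorem strongConvexOn_of_forall_exists_linear_minorant {s : Set V} (hs : Convex ℝ s) {m : ℝ}
    {f : V → ℝ}
    (h : ∀ z ∈ s, ∃ l : V →ₗ[ℝ] ℝ, ∀ x ∈ s, f z + l (x - z) + m / 2 * ‖x - z‖ ^ 2 ≤ f x) :
    StrongConvexOn s m f := by
  refine ⟨hs, fun x hx y hy a b ha hb hab => ?_⟩
  obtain ⟨l, hl⟩ := h _ (hs hx hy ha hb hab)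
  obtain rfl : a = 1 - b := by linarith
  have hxz : x - ((1 - b) • x + b • y) = b • (x - y) := by module
  have hyz : y - ((1 - b) • x + b • y) = (-(1 - b)) • (x - y) := by module
  have hx' := mul_le_mul_of_nonneg_left (hl x hx) ha
  have hy' := mul_le_mul_of_nonneg_left (hl y hy) hb
  rw [hxz, map_smul, norm_smul, Real.norm_eq_abs, mul_pow, sq_abs] at hx'
  rw [hyz, map_smul, norm_smul, Real.norm_eq_abs, mul_pow, sq_abs] at hy'
  simp only [smul_eq_mul] at *
  linarith

theorem strongConvexOn_subset {s t : Set V} {m : ℝ} {f : V → ℝ} (hf : StrongConvexOn t m f)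
    (hst : s ⊆ t) (hs : Convex ℝ s) : StrongConvexOn s m f :=
  ⟨hs, fun _ hx _ hy => hf.2 (hst hx) (hst hy)⟩

theorem strongConvexOn_congr {s : Set V} {m : ℝ} {f g : V → ℝ} (hf : StrongConvexOn s m f)
    (hfg : Set.EqOn f g s) : StrongConvexOn s m g :=
  ⟨hf.1, fun x hx y hy a b ha hb hab => by
    rw [← hfg hx, ← hfg hy, ← hfg (hf.1 hx hy ha hb hab)]
    exact hf.2 hx hy ha hb hab⟩

theorem norm_sub_sub_le_of_fderiv_lipschitz [NormedAddCommGroup F] [NormedSpace ℝ F] {s : Set V}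
    (hs : Convex ℝ s) {φ : V → F} {D : V → V →L[ℝ] F} (hD : ∀ t ∈ s, HasFDerivAt φ (D t) t)
    {K : ℝ} (hK : 0 ≤ K) (hLip : ∀ x ∈ s, ∀ z ∈ s, ‖D x - D z‖ ≤ K * ‖x - z‖) {x z : V}
    (hx : x ∈ s) (hz : z ∈ s) :
    ‖φ x - φ z - D z (x - z)‖ ≤ K * ‖x - z‖ ^ 2 := by
  have hseg : segment ℝ z x ⊆ s := hs.segment_subset hz hx
  rw [sq, ← mul_assoc]
  refine (convex_segment z x).norm_image_sub_le_of_norm_hasFDerivWithin_le'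
    (fun t ht => (hD t (hseg ht)).hasFDerivWithinAt) (fun t ht => ?_)
    (left_mem_segment ℝ z x) (right_mem_segment ℝ z x)
  calc ‖D t - D z‖ ≤ K * ‖t - z‖ := hLip t (hseg ht) z hz
    _ ≤ K * ‖x - z‖ := by gcongr; exact norm_sub_le_of_mem_segment ht

variable [NormedAddCommGroup F] [InnerProductSpace ℝ F]

theorem strongConvexOn_half_norm_sq {s : Set V} (hs : Convex ℝ s) {φ : V → F}
    {D : V → V →L[ℝ] F} (hD : ∀ t ∈ s, HasFDerivAt φ (D t) t) {K η κ : ℝ} (hK : 0 ≤ K)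
    (hκ : 0 ≤ κ) (hLip : ∀ x ∈ s, ∀ z ∈ s, ‖D x - D z‖ ≤ K * ‖x - z‖)
    (hlow : ∀ x ∈ s, ∀ z ∈ s, κ * ‖x - z‖ ≤ ‖φ x - φ z‖) (hη : ∀ z ∈ s, ‖φ z‖ ≤ η) :
    StrongConvexOn s (κ ^ 2 - 2 * (η * K)) fun t => 1 / 2 * ‖φ t‖ ^ 2 := by
  refine strongConvexOn_of_forall_exists_linear_minorant hs fun z hz =>
    ⟨(innerSL ℝ (φ z)).comp (D z), fun x hx => ?_⟩
  set R := φ x - φ z - D z (x - z) with hR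
  have hdiff : φ x - φ z = D z (x - z) + R := by rw [hR]; abel
  have hexpand : ‖φ x‖ ^ 2 =
      ‖φ z‖ ^ 2 + 2 * (inner ℝ (φ z) (D z (x - z)) + inner ℝ (φ z) R) + ‖φ x - φ z‖ ^ 2 := by
    rw [← inner_add_right, ← hdiff, ← norm_add_sq_real, add_sub_cancel]
  have hcross : -(η * (K * ‖x - z‖ ^ 2)) ≤ inner ℝ (φ z) R := by
    refine neg_le_of_abs_le ((abs_real_inner_le_norm _ _).trans ?_)
    exact mul_le_mul (hη z hz) (norm_sub_sub_le_of_fderiv_lipschitz hs hD hK hLip hx hz)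
      (norm_nonneg _) ((norm_nonneg _).trans (hη z hz))
  have hquad : κ ^ 2 * ‖x - z‖ ^ 2 ≤ ‖φ x - φ z‖ ^ 2 := by
    rw [← mul_pow]
    exact pow_le_pow_left₀ (by positivity) (hlow x hx z hz) 2
  simp only [ContinuousLinearMap.coe_coe, ContinuousLinearMap.comp_apply, innerSL_apply_apply]
  linarith

theorem exists_mul_norm_le_norm_sub_of_fderiv_inl {φ : V × W → F} {p : V × W}
    {φ' : V × W →L[ℝ] F} (hφ : HasStrictFDerivAt φ φ' p) {κ : ℝ} (hκ : 0 < κ)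
    (hinj : ∀ h, κ * ‖h‖ ≤ ‖φ' (h, 0)‖) :
    ∃ U ∈ 𝓝 p, ∀ x z c, (x, c) ∈ U → (z, c) ∈ U → κ / 2 * ‖x - z‖ ≤ ‖φ (x, c) - φ (z, c)‖ := by
  obtain ⟨U, hU, happrox⟩ := hφ.approximates_deriv_on_nhds (c := (κ / 2).toNNReal)
    (.inr (Real.toNNReal_pos.2 (half_pos hκ)))
  refine ⟨U, hU, fun x z c hx hz => ?_⟩
  have herr : ‖φ (x, c) - φ (z, c) - φ' (x - z, 0)‖ ≤ κ / 2 * ‖x - z‖ := by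
    simpa [Real.coe_toNNReal _ (half_pos hκ).le] using happrox (x, c) hx (z, c) hz
  have htri := norm_sub_norm_le (φ' (x - z, 0)) (φ (x, c) - φ (z, c))
  rw [norm_sub_rev (φ' _)] at htri
  linarith [hinj (x - z)]

theorem exists_strongConvexOn_half_norm_sq {φ : V × W → F} {p : V × W}
    (hφ : ContDiffAt ℝ 2 φ p) (h0 : φ p = 0) {κ : ℝ} (hκ : 0 < κ)
    (hinj : ∀ h, κ * ‖h‖ ≤ ‖fderiv ℝ φ p (h, 0)‖) :
    ∃ m > 0, ∃ r > 0, ∀ᶠ c in 𝓝 p.2,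
      StrongConvexOn (Metric.ball p.1 r) m fun t => 1 / 2 * ‖φ (t, c)‖ ^ 2 := by
  obtain ⟨K, U, hU, hLip⟩ :=
    (hφ.fderiv_right (m := 1) (by norm_num)).exists_lipschitzOnWith
  obtain ⟨U', hU', hlow⟩ :=
    exists_mul_norm_le_norm_sub_of_fderiv_inl (hφ.hasStrictFDerivAt (by simp)) hκ hinj
  set η := κ ^ 2 / (16 * (K + 1))
  have hη : 0 < η := by positivity
  have hnear : ∀ᶠ z in 𝓝 p, z ∈ U ∧ z ∈ U' ∧ DifferentiableAt ℝ φ z ∧ ‖φ z‖ ≤ η := by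
    refine .and hU (.and hU' (.and ?_ ?_))
    · exact (hφ.eventually (by simp)).mono fun z hz => hz.differentiableAt (by simp)
    · exact hφ.continuousAt.norm.eventually_le_const (by simpa [h0] using hη)
  obtain ⟨r, hr, hball⟩ := Metric.eventually_nhds_iff_ball.1 hnear
  refine ⟨κ ^ 2 / 8, by positivity, r, hr, ?_⟩
  filter_upwards [Metric.ball_mem_nhds p.2 hr] with c hc
  have hmem : ∀ t ∈ Metric.ball p.1 r,
      (t, c) ∈ U ∧ (t, c) ∈ U' ∧ DifferentiableAt ℝ φ (t, c) ∧ ‖φ (t, c)‖ ≤ η := fun t ht =>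
    hball _ (ball_prod_same p.1 p.2 r ▸ Set.mk_mem_prod ht hc)
  have hsc := strongConvexOn_half_norm_sq (convex_ball p.1 r) (φ := fun t => φ (t, c))
    (D := fun t => (fderiv ℝ φ (t, c)).comp (ContinuousLinearMap.inl ℝ V W))
    (fun t ht => (hmem t ht).2.2.1.hasFDerivAt.comp t (hasFDerivAt_prodMk_left t c))
    K.2 (half_pos hκ).le (fun x hx z hz => ?_)
    (fun x hx z hz => hlow x z c (hmem x hx).2.1 (hmem z hz).2.1) (fun z hz => (hmem z hz).2.2.2)
  · refine hsc.mono ?_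
    have hηK : η * (K + 1) = κ ^ 2 / 16 := by simp only [η]; field_simp
    simp only [NNReal.val_eq_coe]
    nlinarith
  · rw [← ContinuousLinearMap.sub_comp]
    calc _ ≤ ‖fderiv ℝ φ (x, c) - fderiv ℝ φ (z, c)‖ * 1 :=
          (ContinuousLinearMap.opNorm_comp_le _ _).trans
            (by gcongr; exact ContinuousLinearMap.norm_inl_le_one ℝ V W)
      _ ≤ K * ‖x - z‖ := by
          simpa [dist_eq_norm] using hLip.dist_le_mul (x, c) (hmem x hx).1 (z, c) (hmem z hz).1

end StrongConvexity

section RayProjection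

open Filter Topology

variable {F : Type*} [NormedAddCommGroup F] [InnerProductSpace ℝ F] {u u₀ c : F} {v : ℝ}

/-- The nonnegative multiple of `u` nearest to `c` is `rayCoeff u c • u`. The value at `u = 0` is
`0`. -/
noncomputable def rayCoeff (u c : F) : ℝ :=
  max 0 (inner ℝ u c / ‖u‖ ^ 2)

/-- The distance from `c` to the ray `{v • u | 0 ≤ v}`. -/
noncomputable def rayDist (u c : F) : ℝ :=
  ‖rayCoeff u c • u - c‖

theorem mul_rayCoeff_mul_norm_sq_sub_inner_nonneg (u c : F) (hv : 0 ≤ v) :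
    0 ≤ (v - rayCoeff u c) * (rayCoeff u c * ‖u‖ ^ 2 - inner ℝ u c) := by
  rcases le_or_gt (inner ℝ u c) 0 with h | h
  · have hcoeff : rayCoeff u c = 0 := max_eq_left (div_nonpos_of_nonpos_of_nonneg h (by positivity))
    rw [hcoeff, sub_zero, zero_mul, zero_sub]
    exact mul_nonneg hv (neg_nonneg.2 h)
  · have hu : u ≠ 0 := fun hu => by simp [hu] at h
    have hcoeff : rayCoeff u c = inner ℝ u c / ‖u‖ ^ 2 := max_eq_right (by positivity)
    rw [hcoeff, div_mul_cancel₀ _ (by positivity), sub_self, mul_zero]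

theorem rayDist_le_norm_smul_sub (u c : F) (hv : 0 ≤ v) : rayDist u c ≤ ‖v • u - c‖ := by
  refine le_of_sq_le_sq ?_ (norm_nonneg _)
  set w := rayCoeff u c
  have hinner : inner ℝ (w • u - c) ((v - w) • u) = (v - w) * (w * ‖u‖ ^ 2 - inner ℝ u c) := by
    rw [real_inner_smul_right, inner_sub_left, real_inner_smul_left, real_inner_self_eq_norm_sq,
      real_inner_comm]
  calc rayDist u c ^ 2 ≤ ‖w • u - c‖ ^ 2 + 2 * inner ℝ (w • u - c) ((v - w) • u) +
        ‖(v - w) • u‖ ^ 2 := by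
        rw [hinner, rayDist]
        linarith [mul_rayCoeff_mul_norm_sq_sub_inner_nonneg u c hv, sq_nonneg ‖(v - w) • u‖]
    _ = ‖v • u - c‖ ^ 2 := by
        rw [← norm_add_sq_real]
        congr 2
        module

theorem norm_rayCoeff_smul_sub_smul_le (hv : 0 ≤ v) (hle : rayDist u c ≤ rayDist u₀ c) :
    ‖rayCoeff u c • u - v • u₀‖ ≤ 2 * ‖c - v • u₀‖ := by
  have hdist : ‖rayCoeff u c • u - c‖ ≤ ‖c - v • u₀‖ :=
    hle.trans (norm_sub_rev (v • u₀) c ▸ rayDist_le_norm_smul_sub u₀ c hv)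
  linarith [norm_sub_le_norm_sub_add_norm_sub (rayCoeff u c • u) c (v • u₀)]

section Normalized

variable {G : Type*} [NormedAddCommGroup G] [NormedSpace ℝ G] {ℓ : G →L[ℝ] ℝ} {u u₀ : G}

theorem abs_sub_le_norm_mul_norm_smul_sub_smul (hu : ℓ u = 1) (hu₀ : ℓ u₀ = 1) (w v : ℝ) :
    |w - v| ≤ ‖ℓ‖ * ‖w • u - v • u₀‖ := by
  simpa [hu, hu₀] using ℓ.le_opNorm (w • u - v • u₀)

theorem mul_norm_sub_le_mul_norm_smul_sub_smul (hu : ℓ u = 1) (hu₀ : ℓ u₀ = 1) {w : ℝ}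
    (hw : 0 ≤ w) (v : ℝ) : w * ‖u - u₀‖ ≤ (1 + ‖ℓ‖ * ‖u₀‖) * ‖w • u - v • u₀‖ := by
  calc w * ‖u - u₀‖ = ‖(w • u - v • u₀) - (w - v) • u₀‖ := by
        rw [← abs_of_nonneg hw, ← Real.norm_eq_abs, ← norm_smul, Real.norm_eq_abs,
          abs_of_nonneg hw]
        congr 1
        module
    _ ≤ ‖w • u - v • u₀‖ + |w - v| * ‖u₀‖ := by
        rw [← Real.norm_eq_abs, ← norm_smul]
        exact norm_sub_le _ _
    _ ≤ ‖w • u - v • u₀‖ + ‖ℓ‖ * ‖w • u - v • u₀‖ * ‖u₀‖ := by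
        gcongr
        exact abs_sub_le_norm_mul_norm_smul_sub_smul hu hu₀ w v
    _ = (1 + ‖ℓ‖ * ‖u₀‖) * ‖w • u - v • u₀‖ := by ring

end Normalized

theorem eventually_mul_norm_sub_lt {G : Type*} [SeminormedAddCommGroup G] (L : ℝ) (c₀ : G) {η : ℝ}
    (hη : 0 < η) : ∀ᶠ c in 𝓝 c₀, L * ‖c - c₀‖ < η := by
  have hcont : Continuous fun c => L * ‖c - c₀‖ := by fun_prop
  exact hcont.continuousAt.eventually_lt continuousAt_const (by simpa using hη)

theorem exists_eventually_abs_rayCoeff_sub_le {ℓ : F →L[ℝ] ℝ} (hu₀ : ℓ u₀ = 1) (hv : 0 < v) :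
    ∃ L > 0, ∀ᶠ c in 𝓝 (v • u₀), ∀ u, ℓ u = 1 → rayDist u c ≤ rayDist u₀ c →
      |rayCoeff u c - v| ≤ L * ‖c - v • u₀‖ ∧ ‖u - u₀‖ ≤ L * ‖c - v • u₀‖ := by
  set B := 1 + ‖ℓ‖ * ‖u₀‖
  have hcoeff : ∀ c u, ℓ u = 1 → rayDist u c ≤ rayDist u₀ c →
      |rayCoeff u c - v| ≤ 2 * ‖ℓ‖ * ‖c - v • u₀‖ := fun c u hu hle =>
    calc |rayCoeff u c - v| ≤ ‖ℓ‖ * ‖rayCoeff u c • u - v • u₀‖ :=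
          abs_sub_le_norm_mul_norm_smul_sub_smul hu hu₀ _ v
      _ ≤ ‖ℓ‖ * (2 * ‖c - v • u₀‖) := by
          gcongr
          exact norm_rayCoeff_smul_sub_smul_le hv.le hle
      _ = 2 * ‖ℓ‖ * ‖c - v • u₀‖ := by ring
  refine ⟨2 * ‖ℓ‖ + 4 * B / v, by positivity,
    (eventually_mul_norm_sub_lt (2 * ‖ℓ‖) _ (half_pos hv)).mono fun c hc u hu hle => ⟨?_, ?_⟩⟩
  · exact (hcoeff c u hu hle).trans
      (mul_le_mul_of_nonneg_right (le_add_of_nonneg_right (by positivity)) (norm_nonneg _))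
  · have hhalf : v / 2 ≤ rayCoeff u c := by
      linarith [neg_le_of_abs_le ((hcoeff c u hu hle).trans hc.le)]
    have hmul : v / 2 * ‖u - u₀‖ ≤ B * (2 * ‖c - v • u₀‖) :=
      calc v / 2 * ‖u - u₀‖ ≤ rayCoeff u c * ‖u - u₀‖ := by gcongr
        _ ≤ B * ‖rayCoeff u c • u - v • u₀‖ :=
            mul_norm_sub_le_mul_norm_smul_sub_smul hu hu₀ (le_max_left _ _) v
        _ ≤ B * (2 * ‖c - v • u₀‖) := by
            gcongr
            exact norm_rayCoeff_smul_sub_smul_le hv.le hle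
    calc ‖u - u₀‖ ≤ 4 * B / v * ‖c - v • u₀‖ := by
          rw [div_mul_eq_mul_div, le_div_iff₀ hv]
          linarith
      _ ≤ (2 * ‖ℓ‖ + 4 * B / v) * ‖c - v • u₀‖ := by
          gcongr
          exact le_add_of_nonneg_left (by positivity)

end RayProjection

section RayFit

open Filter Topology

variable {V F : Type*} [NormedAddCommGroup F]

section Derivative

variable [NormedAddCommGroup V] [NormedSpace ℝ V] [FiniteDimensional ℝ V] [NormedSpace ℝ F]

theorem exists_mul_norm_le_of_injective {D : V →L[ℝ] F} (hD : ∀ h, D h = 0 → h = 0) :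
    ∃ κ > 0, ∀ h, κ * ‖h‖ ≤ ‖D h‖ := by
  obtain ⟨K, hK, hanti⟩ := (D : V →ₗ[ℝ] F).exists_antilipschitzWith (LinearMap.ker_eq_bot'.2 hD)
  refine ⟨(K : ℝ)⁻¹, inv_pos.2 hK, fun h => ?_⟩
  rw [inv_mul_le_iff₀ (NNReal.coe_pos.2 hK)]
  exact hanti.le_mul_norm (map_zero _) h

theorem exists_eventually_norm_sub_le_of_injective_fderiv {f : V → F} {D : V →L[ℝ] F} {t₀ : V}
    (hf : HasFDerivAt f D t₀) (hD : ∀ h, D h = 0 → h = 0) :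
    ∃ L > 0, ∀ᶠ t in 𝓝 t₀, ‖t - t₀‖ ≤ L * ‖f t - f t₀‖ := by
  obtain ⟨κ, hκ, hlow⟩ := exists_mul_norm_le_of_injective hD
  refine ⟨2 / κ, by positivity, ?_⟩
  filter_upwards [hf.isLittleO.def (half_pos hκ)] with t ht
  have htri := norm_sub_norm_le (D (t - t₀)) (f t - f t₀)
  rw [norm_sub_rev (D _)] at htri
  rw [div_mul_eq_mul_div, le_div_iff₀ hκ]
  linarith [hlow (t - t₀)]

end Derivative

variable [InnerProductSpace ℝ F]

/-- The residual `(r(t)ᵀc / ‖r(t)‖²) r(t) - c` of the projection of `c` onto the line through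
`r t`, as a function of `(t, c)`. -/
noncomputable def lineResidual (r : V → F) (z : V × F) : F :=
  (inner ℝ (r z.1) z.2 / ‖r z.1‖ ^ 2) • r z.1 - z.2

variable {r : V → F} {t₀ : V} {v : ℝ}

theorem inner_smul_self_div_norm_sq {u : F} (hu : u ≠ 0) (v : ℝ) :
    inner ℝ u (v • u) / ‖u‖ ^ 2 = v := by
  rw [real_inner_smul_right, real_inner_self_eq_norm_sq, mul_div_cancel_right₀ _ (by positivity)]

theorem lineResidual_smul_self (h0 : r t₀ ≠ 0) (v : ℝ) : lineResidual r (t₀, v • r t₀) = 0 := by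
  rw [lineResidual, inner_smul_self_div_norm_sq h0, sub_self]

variable [NormedAddCommGroup V] [NormedSpace ℝ V]

theorem contDiffAt_inner_div_norm_sq {n : WithTop ℕ∞} (hr : ContDiffAt ℝ n r t₀) (h0 : r t₀ ≠ 0)
    (c : F) : ContDiffAt ℝ n (fun z : V × F => inner ℝ (r z.1) z.2 / ‖r z.1‖ ^ 2) (t₀, c) :=
  ((hr.fst' (y := c)).inner ℝ contDiffAt_snd).div ((hr.fst' (y := c)).norm_sq ℝ) (by simpa using h0)

theorem contDiffAt_lineResidual {n : WithTop ℕ∞} (hr : ContDiffAt ℝ n r t₀) (h0 : r t₀ ≠ 0)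
    (c : F) : ContDiffAt ℝ n (lineResidual r) (t₀, c) :=
  ((contDiffAt_inner_div_norm_sq hr h0 c).smul (hr.fst' (y := c))).sub contDiffAt_snd

theorem exists_fderiv_lineResidual_inl (hr : ContDiffAt ℝ 1 r t₀) (h0 : r t₀ ≠ 0) (v : ℝ) (h : V) :
    ∃ s : ℝ, fderiv ℝ (lineResidual r) (t₀, v • r t₀) (h, 0) =
      v • fderiv ℝ r t₀ h + s • r t₀ := by
  have hcoeff := (contDiffAt_inner_div_norm_sq hr h0 (v • r t₀)).differentiableAt (by simp)
  have hfst : HasFDerivAt (fun z : V × F => r z.1)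
      ((fderiv ℝ r t₀).comp (ContinuousLinearMap.fst ℝ V F)) (t₀, v • r t₀) :=
    (hr.differentiableAt (by simp)).hasFDerivAt.comp (f := Prod.fst) _ hasFDerivAt_fst
  have hD : HasFDerivAt (lineResidual r) _ (t₀, v • r t₀) :=
    (hcoeff.hasFDerivAt.smul hfst).sub hasFDerivAt_snd
  use fderiv ℝ (fun z : V × F => inner ℝ (r z.1) z.2 / ‖r z.1‖ ^ 2) (t₀, v • r t₀) (h, 0)
  simp [hD.fderiv, inner_smul_self_div_norm_sq h0]

theorem exists_strongConvexOn_half_rayDist_sq [FiniteDimensional ℝ V] (hv : 0 < v)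
    (hr : ContDiffAt ℝ 2 r t₀) (h0 : r t₀ ≠ 0)
    (hinj : ∀ (h : V) (s : ℝ), fderiv ℝ r t₀ h + s • r t₀ = 0 → h = 0) :
    ∃ m > 0, ∃ δ > 0, ∀ᶠ c in 𝓝 (v • r t₀),
      StrongConvexOn (Metric.ball t₀ δ) m fun t => 1 / 2 * rayDist (r t) c ^ 2 := by
  have hker : ∀ h, (fderiv ℝ (lineResidual r) (t₀, v • r t₀)).comp
      (ContinuousLinearMap.inl ℝ V F) h = 0 → h = 0 := fun h hz => by
    obtain ⟨s, hs⟩ := exists_fderiv_lineResidual_inl (hr.of_le (by norm_num)) h0 v h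
    refine (smul_eq_zero.1 (hinj (v • h) s ?_)).resolve_left hv.ne'
    rw [map_smul, ← hs]
    exact hz
  obtain ⟨κ, hκ, hlow⟩ := exists_mul_norm_le_of_injective hker
  obtain ⟨m, hm, δ₁, hδ₁, hsc⟩ := exists_strongConvexOn_half_norm_sq
    (contDiffAt_lineResidual hr h0 (v • r t₀)) (lineResidual_smul_self h0 v) hκ hlow
  have hpos : ∀ᶠ z : V × F in 𝓝 (t₀, v • r t₀), 0 < inner ℝ (r z.1) z.2 / ‖r z.1‖ ^ 2 :=
    continuousAt_const.eventually_lt (contDiffAt_inner_div_norm_sq hr h0 _).continuousAt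
      (by rwa [inner_smul_self_div_norm_sq h0])
  obtain ⟨δ₂, hδ₂, hball⟩ := Metric.eventually_nhds_iff_ball.1 hpos
  refine ⟨m, hm, min δ₁ δ₂, lt_min hδ₁ hδ₂, ?_⟩
  filter_upwards [hsc, Metric.ball_mem_nhds _ hδ₂] with c hc hcball
  refine strongConvexOn_congr (strongConvexOn_subset hc
    (Metric.ball_subset_ball (min_le_left _ _)) (convex_ball _ _)) fun t ht => ?_
  have hpos_t : 0 < inner ℝ (r t) c / ‖r t‖ ^ 2 := hball (t, c) (by
    rw [← ball_prod_same]
    exact Set.mk_mem_prod (Metric.ball_subset_ball (min_le_right _ _) ht) hcball)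
  simp only [lineResidual, rayDist, rayCoeff, max_eq_right hpos_t.le]

end RayFit

section RayFitSolution

open Filter Topology

variable {V F : Type*} [NormedAddCommGroup V] [NormedAddCommGroup F] [InnerProductSpace ℝ F]
  {r : V → F} {t₀ : V} {T : Set V} {ℓ : F →L[ℝ] ℝ} {v : ℝ}

theorem eventually_norm_sub_le_of_rayDist_le (hℓ : ∀ t ∈ T, ℓ (r t) = 1) (ht₀ : t₀ ∈ T)
    (hv : 0 < v) (hid : ∀ δ > 0, ∃ η > 0, ∀ t ∈ T, ‖r t - r t₀‖ ≤ η → ‖t - t₀‖ ≤ δ)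
    {δ : ℝ} (hδ : 0 < δ) :
    ∀ᶠ c in 𝓝 (v • r t₀), ∀ t ∈ T, rayDist (r t) c ≤ rayDist (r t₀) c → ‖t - t₀‖ ≤ δ := by
  obtain ⟨L, -, hL⟩ := exists_eventually_abs_rayCoeff_sub_le (hℓ t₀ ht₀) hv
  obtain ⟨η, hη, hidη⟩ := hid δ hδ
  filter_upwards [hL, eventually_mul_norm_sub_lt L _ hη] with c hc hcη t ht hle
  exact hidη t ht ((hc _ (hℓ t ht) hle).2.trans hcη.le)

theorem continuousAt_rayDist_comp {X : Type*} [TopologicalSpace X] {f : X → F} {a : X}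
    (hf : ContinuousAt f a) (h0 : f a ≠ 0) (c : F) :
    ContinuousAt (fun t => rayDist (f t) c) a := by
  have hcoeff : ContinuousAt (fun t => rayCoeff (f t) c) a :=
    continuousAt_const.sup ((hf.inner continuousAt_const).div (hf.norm.pow 2) (by simpa using h0))
  exact ((hcoeff.smul hf).sub continuousAt_const).norm

variable [NormedSpace ℝ V] [FiniteDimensional ℝ V]

theorem exists_eventually_norm_sub_le_of_rayDist_le (hℓ : ∀ t ∈ T, ℓ (r t) = 1) (ht₀ : t₀ ∈ T)
    (hv : 0 < v) (hid : ∀ δ > 0, ∃ η > 0, ∀ t ∈ T, ‖r t - r t₀‖ ≤ η → ‖t - t₀‖ ≤ δ)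
    {D : V →L[ℝ] F} (hr : HasFDerivAt r D t₀) (hD : ∀ h, D h = 0 → h = 0) :
    ∃ L > 0, ∀ᶠ c in 𝓝 (v • r t₀), ∀ t ∈ T, rayDist (r t) c ≤ rayDist (r t₀) c →
      ‖t - t₀‖ ≤ L * ‖c - v • r t₀‖ ∧ |rayCoeff (r t) c - v| ≤ L * ‖c - v • r t₀‖ := by
  obtain ⟨L₁, hL₁, hfit⟩ := exists_eventually_abs_rayCoeff_sub_le (hℓ t₀ ht₀) hv
  obtain ⟨L₂, hL₂, hinv⟩ := exists_eventually_norm_sub_le_of_injective_fderiv hr hD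
  obtain ⟨δ, hδ, hball⟩ := Metric.nhds_basis_closedBall.eventually_iff.1 hinv
  refine ⟨L₂ * L₁ + L₁, by positivity, ?_⟩
  filter_upwards [hfit, eventually_norm_sub_le_of_rayDist_le hℓ ht₀ hv hid hδ]
    with c hc hloc t ht hle
  obtain ⟨hcoeff, hdir⟩ := hc _ (hℓ t ht) hle
  constructor
  · calc ‖t - t₀‖ ≤ L₂ * ‖r t - r t₀‖ := hball (mem_closedBall_iff_norm.2 (hloc t ht hle))
      _ ≤ L₂ * (L₁ * ‖c - v • r t₀‖) := by gcongr
      _ = L₂ * L₁ * ‖c - v • r t₀‖ := by ring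
      _ ≤ (L₂ * L₁ + L₁) * ‖c - v • r t₀‖ := by
          gcongr
          exact le_add_of_nonneg_right hL₁.le
  · refine hcoeff.trans (mul_le_mul_of_nonneg_right ?_ (norm_nonneg _))
    exact le_add_of_nonneg_left (by positivity)

/- Outside a small ball about `t₀` the fit is worse than that of `t₀`, so that compactness of the
ball suffices. -/
theorem eventually_exists_isMinOn_rayDist (hℓ : ∀ t ∈ T, ℓ (r t) = 1) (hT : T ∈ 𝓝 t₀)
    (hv : 0 < v) (hid : ∀ δ > 0, ∃ η > 0, ∀ t ∈ T, ‖r t - r t₀‖ ≤ η → ‖t - t₀‖ ≤ δ)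
    (hr : ∀ᶠ t in 𝓝 t₀, ContinuousAt r t) :
    ∀ᶠ c in 𝓝 (v • r t₀), ∃ t ∈ T, IsMinOn (fun t => rayDist (r t) c) T t := by
  have : ProperSpace V := FiniteDimensional.proper_real V
  obtain ⟨δ, hδ, hball⟩ := Metric.nhds_basis_closedBall.eventually_iff.1 (hr.and hT)
  have hself : t₀ ∈ Metric.closedBall t₀ δ := Metric.mem_closedBall_self hδ.le
  filter_upwards [eventually_norm_sub_le_of_rayDist_le hℓ (mem_of_mem_nhds hT) hv hid hδ]
    with c hloc
  have hcont : ContinuousOn (fun t => rayDist (r t) c) (Metric.closedBall t₀ δ) := fun t ht =>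
    have hne : r t ≠ 0 := fun h => by simpa [h] using hℓ t (hball ht).2
    (continuousAt_rayDist_comp (hball ht).1 hne c).continuousWithinAt
  obtain ⟨t, ht, hmin⟩ := (isCompact_closedBall t₀ δ).exists_isMinOn ⟨t₀, hself⟩ hcont
  refine ⟨t, (hball ht).2, fun u hu => ?_⟩
  rcases le_total (rayDist (r u) c) (rayDist (r t₀) c) with hle | hge
  · exact hmin (mem_closedBall_iff_norm.2 (hloc u hu hle))
  · exact (hmin hself).trans hge

end RayFitSolution

section StageTwo

open Filter Topology

variable {d q n : ℕ} {k : E d → E d → E q → ℝ} {x : Fin n → E d} {c : LongVec n}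

theorem stageTwoObj_eq_half_rayDist_sq (c : LongVec n) :
    stageTwoObj k x c = fun t => 1 / 2 * rayDist (corrVec k x t) c ^ 2 :=
  rfl

theorem stageTwoObj_le_stageTwoObj_iff {t u : E q} :
    stageTwoObj k x c t ≤ stageTwoObj k x c u ↔
      rayDist (corrVec k x t) c ≤ rayDist (corrVec k x u) c := by
  rw [stageTwoObj_eq_half_rayDist_sq, mul_le_mul_iff_right₀ (by norm_num)]
  exact pow_le_pow_iff_left₀ (norm_nonneg _) (norm_nonneg _) two_ne_zero

theorem eq_zero_of_clm_apply_add_smul_eq_zero {F : Type*} [NormedAddCommGroup F] [NormedSpace ℝ F]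
    {u : F} {D : E q →L[ℝ] F}
    (hli : LinearIndependent ℝ
      (Fin.cons u (fun j : Fin q => D (EuclideanSpace.single j (1 : ℝ))) : Fin (q + 1) → F))
    {h : E q} {s : ℝ} (hz : D h + s • u = 0) : h = 0 := by
  have hsum : D h = ∑ j, h j • D (EuclideanSpace.single j (1 : ℝ)) := by
    conv_lhs => rw [← (EuclideanSpace.basisFun (Fin q) ℝ).sum_repr h]
    simp
  have hcoeff := Fintype.linearIndependent_iff.1 hli (Fin.cons s fun j => h j) (by
    simp only [Fin.sum_univ_succ, Fin.cons_zero, Fin.cons_succ]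
    rw [← hsum, add_comm, hz])
  ext j
  simpa using hcoeff j.succ

theorem norm_param_sub_le (θ θ' : Param q) :
    ‖θ - θ'‖ ≤ ‖θ.fst - θ'.fst‖ + |θ.snd - θ'.snd| := by
  rw [WithLp.prod_norm_eq_of_L2]
  refine Real.sqrt_le_iff.2 ⟨by positivity, ?_⟩
  simp only [WithLp.sub_fst, WithLp.sub_snd, Real.norm_eq_abs]
  nlinarith [mul_nonneg (norm_nonneg (θ.fst - θ'.fst)) (abs_nonneg (θ.snd - θ'.snd))]

theorem exists_isStageTwo_of_isMinOn {Θρ : Set (E q)} {t : E q} (ht : t ∈ Θρ)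
    (hmin : IsMinOn (fun t => rayDist (corrVec k x t) c) Θρ t) :
    ∃ θhat, IsStageTwo k x Θρ c θhat :=
  ⟨WithLp.toLp 2 (t, fitVar k x c t), ht,
    fun _ hu => stageTwoObj_le_stageTwoObj_iff.2 (hmin hu), rfl⟩

theorem exists_eventually_isStageTwo {Θρ : Set (E q)} {θ : Param q} {i : Fin n}
    (hdiag : ∀ t ∈ Θρ, k (x i) (x i) t = 1) (hρ : θ.fst ∈ interior Θρ) (hv : 0 < θ.snd)
    (hid : IdentifiableAt k x Θρ θ.fst) (hr : ContDiffAt ℝ 2 (corrVec k x) θ.fst)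
    (hli : LinearIndependent ℝ (Fin.cons (corrVec k x θ.fst)
      (fun j : Fin q => fderiv ℝ (corrVec k x) θ.fst (EuclideanSpace.single j (1 : ℝ))) :
        Fin (q + 1) → LongVec n)) :
    ∃ L > 0, ∃ m > 0, ∃ δ > 0, ∀ᶠ c in 𝓝 (θ.snd • corrVec k x θ.fst),
      (∃ θhat, IsStageTwo k x Θρ c θhat) ∧ ∀ θhat, IsStageTwo k x Θρ c θhat →
        ‖θhat - θ‖ ≤ L * ‖c - θ.snd • corrVec k x θ.fst‖ ∧
        StrongConvexOn (Metric.ball θhat.fst δ) m (stageTwoObj k x c) := by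
  have hℓ : ∀ t ∈ Θρ, EuclideanSpace.proj (𝕜 := ℝ) (i, i) (corrVec k x t) = 1 := hdiag
  have hinj : ∀ h s, fderiv ℝ (corrVec k x) θ.fst h + s • corrVec k x θ.fst = 0 → h = 0 :=
    fun _ _ => eq_zero_of_clm_apply_add_smul_eq_zero hli
  have hρ' : θ.fst ∈ Θρ := interior_subset hρ
  obtain ⟨L, hL, herr⟩ := exists_eventually_norm_sub_le_of_rayDist_le hℓ hρ' hv hid
    (hr.differentiableAt (by simp)).hasFDerivAt fun h hz => hinj h 0 (by rw [hz]; simp)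
  obtain ⟨m, hm, δ, hδ, hconv⟩ :=
    exists_strongConvexOn_half_rayDist_sq hv hr (by simpa using hli.ne_zero 0) hinj
  have hcont : ∀ᶠ t in 𝓝 θ.fst, ContinuousAt (corrVec k x) t :=
    (hr.eventually (by simp)).mono fun _ => ContDiffAt.continuousAt
  refine ⟨2 * L, by positivity, m, hm, δ / 2, half_pos hδ, ?_⟩
  filter_upwards [herr, hconv,
    eventually_norm_sub_le_of_rayDist_le hℓ hρ' hv hid (half_pos hδ),
    eventually_exists_isMinOn_rayDist hℓ (mem_interior_iff_mem_nhds.1 hρ) hv hid hcont]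
    with c herr hconv hloc ⟨t, ht, hmin⟩
  refine ⟨exists_isStageTwo_of_isMinOn ht hmin, fun θhat ⟨hmem, hopt, hvar⟩ => ?_⟩
  have hle := stageTwoObj_le_stageTwoObj_iff.1 (hopt hρ')
  constructor
  · obtain ⟨hfst, hsnd⟩ := herr _ hmem hle
    have hsnd' : |θhat.snd - θ.snd| ≤ L * ‖c - θ.snd • corrVec k x θ.fst‖ := hvar ▸ hsnd
    linarith [norm_param_sub_le θhat θ]
  · refine strongConvexOn_subset hconv (Metric.ball_subset_ball' ?_) (convex_ball _ _)
    rw [dist_eq_norm]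
    linarith [hloc _ hmem hle]

end StageTwo

section Chernoff

open Filter Topology

variable {Ω ι : Type*} [MeasurableSpace Ω] {μ : Measure Ω}

theorem exists_eventually_mgf_le_exp_mul_sq [IsProbabilityMeasure μ] {X : Ω → ℝ}
    (hX : 0 ∈ interior (integrableExpSet X μ)) (hmean : μ[X] = 0) :
    ∃ V, ∀ᶠ s in 𝓝 0, mgf X μ s ≤ Real.exp (V * s ^ 2) := by
  have hcgf : AnalyticAt ℝ (cgf X μ) 0 := analyticAt_cgf hX
  have horder : ((2 : ℕ) : ℕ∞) ≤ analyticOrderAt (cgf X μ) 0 := by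
    refine (natCast_le_analyticOrderAt_iff_iteratedDeriv_eq_zero hcgf).2 fun j hj => ?_
    interval_cases j <;> simp [deriv_cgf_zero hX, hmean]
  obtain ⟨h, hh, hfactor⟩ := (natCast_le_analyticOrderAt hcgf).1 horder
  refine ⟨h 0 + 1, ?_⟩
  filter_upwards [hfactor, mem_interior_iff_mem_nhds.1 hX,
    hh.continuousAt.eventually_lt continuousAt_const (lt_add_one (h 0))] with s hs hint hlt
  rw [← exp_cgf hint, hs, sub_zero, smul_eq_mul, mul_comm]
  gcongr

variable [Fintype ι] {X : ι → Ω → ℝ}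

theorem mem_integrableExpSet_sum (hind : iIndepFun X μ) (hX : ∀ i, AEMeasurable (X i) μ) {s : ℝ}
    (hs : ∀ i, s ∈ integrableExpSet (X i) μ) : s ∈ integrableExpSet (∑ i, X i) μ := by
  have := hind.isProbabilityMeasure
  by_contra hcon
  have hzero : mgf (∑ i, X i) μ s = 0 := mgf_undef hcon
  rw [hind.mgf_sum₀ hX] at hzero
  exact (Finset.prod_pos fun i _ => mgf_pos (hs i)).ne' hzero

theorem measureReal_le_sum_le_exp (hind : iIndepFun X μ) (hX : ∀ i, AEMeasurable (X i) μ)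
    {s V : ℝ} (hs : 0 ≤ s) (hint : ∀ i, s ∈ integrableExpSet (X i) μ)
    (hmgf : ∀ i, mgf (X i) μ s ≤ Real.exp (V * s ^ 2)) (t : ℝ) :
    μ.real {ω | Fintype.card ι * t ≤ ∑ i, X i ω} ≤
      Real.exp (Fintype.card ι * (V * s ^ 2 - s * t)) := by
  have := hind.isProbabilityMeasure
  have hchernoff := measure_ge_le_exp_mul_mgf (Fintype.card ι * t) hs
    (mem_integrableExpSet_sum hind hX hint)
  simp only [Finset.sum_apply] at hchernoff
  calc μ.real {ω | Fintype.card ι * t ≤ ∑ i, X i ω}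
      ≤ Real.exp (-s * (Fintype.card ι * t)) * ∏ i, mgf (X i) μ s :=
        hind.mgf_sum₀ hX Finset.univ ▸ hchernoff
    _ ≤ Real.exp (-s * (Fintype.card ι * t)) * ∏ _i : ι, Real.exp (V * s ^ 2) := by
        gcongr with i
        · exact fun _ _ => mgf_nonneg
        · exact hmgf i
    _ = Real.exp (Fintype.card ι * (V * s ^ 2 - s * t)) := by
        rw [Finset.prod_const, Finset.card_univ, ← Real.exp_nat_mul, ← Real.exp_add]
        ring_nf

/- The exponent `V s² - s t` is minimal at `s = t / (2 V)`. -/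
theorem measureReal_le_abs_sum_le_two_mul_exp (hind : iIndepFun X μ)
    (hX : ∀ i, AEMeasurable (X i) μ) {t V : ℝ} (ht : 0 ≤ t) (hV : 0 < V)
    (hint : ∀ i s, |s| = t / (2 * V) → s ∈ integrableExpSet (X i) μ)
    (hmgf : ∀ i s, |s| = t / (2 * V) → mgf (X i) μ s ≤ Real.exp (V * s ^ 2)) :
    μ.real {ω | Fintype.card ι * t ≤ |∑ i, X i ω|} ≤
      2 * Real.exp (-(Fintype.card ι * t ^ 2 / (4 * V))) := by
  have := hind.isProbabilityMeasure
  have hs : 0 ≤ t / (2 * V) := by positivity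
  have habs : |t / (2 * V)| = t / (2 * V) := abs_of_nonneg hs
  have habs_neg : |-(t / (2 * V))| = t / (2 * V) := by rw [abs_neg, habs]
  have hexponent : Fintype.card ι * (V * (t / (2 * V)) ^ 2 - t / (2 * V) * t) =
      -(Fintype.card ι * t ^ 2 / (4 * V)) := by
    field_simp
    ring
  have hupper := measureReal_le_sum_le_exp hind hX hs (fun i => hint i _ habs)
    (fun i => hmgf i _ habs) t
  have hlower := measureReal_le_sum_le_exp (X := fun i => -X i) (t := t) (V := V)
    (hind.comp (fun _ => Neg.neg) fun _ => measurable_neg) (fun i => (hX i).neg) hs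
    (fun i => by
      simpa only [integrableExpSet, Set.mem_ofPred_eq, Pi.neg_apply, mul_neg, neg_mul]
        using hint i _ habs_neg)
    (fun i => by
      simpa only [mgf_neg, neg_sq] using hmgf i _ habs_neg)
  rw [hexponent] at hupper hlower
  have hsub : {ω | Fintype.card ι * t ≤ |∑ i, X i ω|} ⊆
      {ω | Fintype.card ι * t ≤ ∑ i, X i ω} ∪ {ω | Fintype.card ι * t ≤ ∑ i, (-X i) ω} :=
    fun ω hω => by
      simpa only [Set.mem_union, Set.mem_ofPred_eq, Pi.neg_apply, Finset.sum_neg_distrib]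
        using le_abs.1 hω
  linarith [measureReal_mono (μ := μ) hsub, measureReal_union_le (μ := μ)
    {ω | Fintype.card ι * t ≤ ∑ i, X i ω} {ω | Fintype.card ι * t ≤ ∑ i, (-X i) ω}]

theorem measureReal_iUnion_le_card_mul {B : ι → Set Ω} {p : ℝ} (h : ∀ i, μ.real (B i) ≤ p) :
    μ.real (⋃ i, B i) ≤ Fintype.card ι * p := by
  refine (measureReal_iUnion_fintype_le _).trans ?_
  simpa using Finset.sum_le_card_nsmul Finset.univ _ p fun i _ => h i

end Chernoff

section SecondMoment

open Filter Topology
open scoped Matrix.Norms.Frobenius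

theorem zero_mem_interior_integrableExpSet_of_abs_le {Ω : Type*} [MeasurableSpace Ω]
    {μ : Measure Ω} {X Y : Ω → ℝ} (hX : AEMeasurable X μ) {c : ℝ} (hc : 0 < c)
    (hY : Integrable (fun ω => Real.exp (c * Y ω)) μ) (hle : ∀ ω, |X ω| ≤ Y ω) :
    0 ∈ interior (integrableExpSet X μ) := by
  rw [mem_interior_iff_mem_nhds]
  filter_upwards [Metric.ball_mem_nhds (0 : ℝ) hc] with s hs
  have hs' : |s| < c := by simpa using hs
  refine hY.mono' (by fun_prop) (.of_forall fun ω => ?_)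
  rw [Real.norm_eq_abs, Real.abs_exp]
  refine Real.exp_le_exp.2 ((le_abs_self _).trans ?_)
  rw [abs_mul]
  gcongr
  exact hle ω

theorem abs_mul_sub_le_norm_sq_add {n : ℕ} (z : E n) (i j : Fin n) (m : ℝ) :
    |z i * z j - m| ≤ ‖z‖ ^ 2 + |m| := by
  refine (abs_sub _ _).trans (add_le_add_left ?_ _)
  rw [abs_mul, sq]
  gcongr
  · exact PiLp.norm_apply_le z i
  · exact PiLp.norm_apply_le z j

variable {n : ℕ} {ν : Measure (E n)} {C : Matrix (Fin n) (Fin n) ℝ} {c : ℝ}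

theorem zero_mem_interior_integrableExpSet_mul_sub (hc : 0 < c)
    (hν : Integrable (fun z => Real.exp (c * ‖z‖ ^ 2)) ν) (i j : Fin n) (m : ℝ) :
    0 ∈ interior (integrableExpSet (fun z : E n => z i * z j - m) ν) := by
  refine zero_mem_interior_integrableExpSet_of_abs_le (by fun_prop) hc ?_
    fun z => abs_mul_sub_le_norm_sq_add z i j m
  simpa only [mul_add, Real.exp_add] using hν.mul_const _

theorem integral_mul_sub_eq_zero [IsProbabilityMeasure ν] (hc : 0 < c)
    (hν : Integrable (fun z => Real.exp (c * ‖z‖ ^ 2)) ν)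
    (hC : ∀ i j, ∫ z : E n, z i * z j ∂ν = C i j) (i j : Fin n) :
    ∫ z : E n, (z i * z j - C i j) ∂ν = 0 := by
  have hint : Integrable (fun z : E n => z i * z j) ν := by
    simpa using integrable_of_mem_interior_integrableExpSet
      (zero_mem_interior_integrableExpSet_mul_sub hc hν i j 0)
  rw [integral_sub hint (integrable_const _), hC]
  simp

theorem exists_eventually_forall_mgf_mul_sub_le [IsProbabilityMeasure ν] (hc : 0 < c)
    (hν : Integrable (fun z => Real.exp (c * ‖z‖ ^ 2)) ν)
    (hC : ∀ i j, ∫ z : E n, z i * z j ∂ν = C i j) :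
    ∃ V > 0, ∀ᶠ s in 𝓝 0, ∀ i j, s ∈ integrableExpSet (fun z : E n => z i * z j - C i j) ν ∧
      mgf (fun z : E n => z i * z j - C i j) ν s ≤ Real.exp (V * s ^ 2) := by
  have hinterior := fun i j => zero_mem_interior_integrableExpSet_mul_sub hc hν i j (C i j)
  choose V hV using fun p : Fin n × Fin n => exists_eventually_mgf_le_exp_mul_sq
    (hinterior p.1 p.2) (integral_mul_sub_eq_zero hc hν hC p.1 p.2)
  obtain ⟨B, hB⟩ := Finite.exists_le V
  refine ⟨max B 1, by positivity, eventually_all.2 fun i => eventually_all.2 fun j => ?_⟩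
  filter_upwards [hV (i, j), mem_interior_iff_mem_nhds.1 (hinterior i j)] with s hs hmem
  refine ⟨hmem, hs.trans (Real.exp_le_exp.2 ?_)⟩
  gcongr
  exact (hB (i, j)).trans (le_max_left _ _)

theorem sum_mul_sub_eq_nat_mul_sampleCov_sub {N : ℕ} (y : Fin N → E n) (i j : Fin n) (m : ℝ) :
    ∑ s, (y s i * y s j - m) = N * (sampleCov y i j - m) := by
  rcases N.eq_zero_or_pos with rfl | hN
  · simp
  · simp only [sampleCov, Matrix.of_apply, Finset.sum_sub_distrib, Finset.sum_const,
      Finset.card_univ, Fintype.card_fin, nsmul_eq_mul]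
    field_simp

theorem exists_measureReal_lt_abs_sampleCov_sub_le [IsProbabilityMeasure ν] (hc : 0 < c)
    (hν : Integrable (fun z => Real.exp (c * ‖z‖ ^ 2)) ν)
    (hC : ∀ i j, ∫ z : E n, z i * z j ∂ν = C i j) :
    ∃ U > 0, ∃ t₁ > 0, ∀ (N : ℕ) (t : ℝ), 0 ≤ t → t ≤ t₁ →
      ∀ (Ω : Type*) [MeasurableSpace Ω] (μ : Measure Ω) (y : Fin N → Ω → E n), iIndepFun y μ →
        (∀ s, HasLaw (y s) ν μ) → ∀ i j,
        μ.real {ω | t < |sampleCov (fun s => y s ω) i j - C i j|} ≤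
          2 * Real.exp (-(N * t ^ 2 / U)) := by
  obtain ⟨V, hV, hmgf⟩ := exists_eventually_forall_mgf_mul_sub_le hc hν hC
  obtain ⟨r, hr, hball⟩ := Metric.nhds_basis_closedBall.eventually_iff.1 hmgf
  refine ⟨4 * V, by positivity, 2 * V * r, by positivity,
    fun N t ht htr Ω _ μ y hind hlaw i j => ?_⟩
  have hentry : Measurable fun z : E n => z i * z j - C i j := by fun_prop
  have hident : ∀ s, IdentDistrib (fun ω => y s ω i * y s ω j - C i j)
      (fun z : E n => z i * z j - C i j) μ ν :=
    fun s => ((hlaw s).identDistrib HasLaw.id).comp hentry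
  have hsmall : ∀ {s : ℝ}, |s| = t / (2 * V) → s ∈ Metric.closedBall 0 r := fun {s} hs => by
    rw [mem_closedBall_zero_iff, Real.norm_eq_abs, hs, div_le_iff₀ (by positivity)]
    linarith
  have hbound := measureReal_le_abs_sum_le_two_mul_exp
    (hind.comp (fun _ z => z i * z j - C i j) fun _ => hentry)
    (fun s => (hident s).aemeasurable_fst) ht hV
    (fun s u hu => ((hident s).comp (u := fun a => Real.exp (u * a)) (by fun_prop)).integrable_iff.2
      (hball (hsmall hu) i j).1)
    (fun s u hu => (congrFun (mgf_congr_identDistrib (hident s)) u).trans_le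
      (hball (hsmall hu) i j).2)
  have := hind.isProbabilityMeasure
  simp only [Function.comp_apply, Fintype.card_fin, sum_mul_sub_eq_nat_mul_sampleCov_sub,
    abs_mul, Nat.abs_cast] at hbound
  exact (measureReal_mono fun ω hω =>
    mul_le_mul_of_nonneg_left (Set.mem_ofPred_eq ▸ hω).le N.cast_nonneg).trans hbound

theorem exists_measureReal_lt_norm_sampleCov_sub_le [IsProbabilityMeasure ν] (hc : 0 < c)
    (hν : Integrable (fun z => Real.exp (c * ‖z‖ ^ 2)) ν)
    (hC : ∀ i j, ∫ z : E n, z i * z j ∂ν = C i j) :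
    ∃ U > 0, ∃ t₁ > 0, ∀ (N : ℕ) (t : ℝ), 0 ≤ t → t ≤ t₁ →
      ∀ (Ω : Type*) [MeasurableSpace Ω] (μ : Measure Ω) (y : Fin N → Ω → E n), iIndepFun y μ →
        (∀ s, HasLaw (y s) ν μ) →
        μ.real {ω | n * t < ‖sampleCov (fun s => y s ω) - C‖} ≤
          2 * n ^ 2 * Real.exp (-(N * t ^ 2 / U)) := by
  obtain ⟨U, hU, t₁, ht₁, hentry⟩ := exists_measureReal_lt_abs_sampleCov_sub_le hc hν hC
  refine ⟨U, hU, t₁, ht₁, fun N t ht htt₁ Ω _ μ y hind hlaw => ?_⟩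
  have := hind.isProbabilityMeasure
  have hsub : {ω | n * t < ‖sampleCov (fun s => y s ω) - C‖} ⊆ ⋃ p : Fin n × Fin n,
      {ω | t < |sampleCov (fun s => y s ω) p.1 p.2 - C p.1 p.2|} := fun ω hω => by
    by_contra! hcon
    simp only [Set.mem_iUnion, Set.mem_ofPred_eq, not_exists, not_lt] at hcon
    have hnorm : ‖sampleCov (fun s => y s ω) - C‖ ≤ Fintype.card (Fin n) * t :=
      frobenius_norm_le_of_abs_apply_le ht fun i j => hcon (i, j)
    rw [Fintype.card_fin] at hnorm
    exact hnorm.not_gt hω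
  calc μ.real {ω | n * t < ‖sampleCov (fun s => y s ω) - C‖}
      ≤ μ.real (⋃ p : Fin n × Fin n,
          {ω | t < |sampleCov (fun s => y s ω) p.1 p.2 - C p.1 p.2|}) :=
        measureReal_mono hsub
    _ ≤ Fintype.card (Fin n × Fin n) * (2 * Real.exp (-(N * t ^ 2 / U))) :=
        measureReal_iUnion_le_card_mul fun p => hentry N t ht htt₁ Ω μ y hind hlaw p.1 p.2
    _ = 2 * n ^ 2 * Real.exp (-(N * t ^ 2 / U)) := by
        simp only [Fintype.card_prod, Fintype.card_fin, Nat.cast_mul]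
        ring

theorem integral_eval_mul_eval_multivariateGaussian (hC : C.PosSemidef) (i j : Fin n) :
    ∫ z : E n, z i * z j ∂(multivariateGaussian 0 C) = C i j := by
  have hmean : ∀ i, ∫ z : E n, z i ∂(multivariateGaussian 0 C) = 0 := fun i => by
    simpa using (EuclideanSpace.proj i : E n →L[ℝ] ℝ).integral_comp_comm
      (μ := multivariateGaussian 0 C) (φ := id) IsGaussian.integrable_id
  rw [← covariance_eval_multivariateGaussian (μ := 0) hC i j, covariance]
  simp [hmean]

end SecondMoment

section SampleSize

variable {n : ℕ} {M : ℝ}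

theorem sampleBase_pos (hM : 0 < M) : 0 < sampleBase n M := by
  have hlog : 0 ≤ Real.log n := Real.log_natCast_nonneg n
  have hlog4 : 0 < Real.log 4 := Real.log_pos (by norm_num)
  exact Nat.ceil_pos.2 (by positivity)

theorem two_mul_sq_mul_exp_sampleBase_le (hn : 0 < n) (hM : 0 < M) :
    2 * (n : ℝ) ^ 2 * Real.exp (-((1 + Real.log (2 * n ^ 2)) * sampleBase n M)) ≤
      (n : ℝ) ^ (-M) := by
  have hn' : (0 : ℝ) < n := by exact_mod_cast hn
  have hΛ : 0 ≤ Real.log (2 * n ^ 2) := by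
    exact_mod_cast Real.log_natCast_nonneg (2 * n ^ 2)
  have hMlog : 0 ≤ M * Real.log n := mul_nonneg hM.le (Real.log_natCast_nonneg n)
  have hlog4 : 0 < Real.log 4 := Real.log_pos (by norm_num)
  have hbase : M * Real.log n ≤ sampleBase n M := by
    refine le_trans ?_ (Nat.le_ceil _)
    linarith
  have hbase_one : (1 : ℝ) ≤ sampleBase n M := by exact_mod_cast sampleBase_pos hM
  calc 2 * (n : ℝ) ^ 2 * Real.exp (-((1 + Real.log (2 * n ^ 2)) * sampleBase n M))
      = Real.exp (Real.log (2 * n ^ 2) - (1 + Real.log (2 * n ^ 2)) * sampleBase n M) := by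
        rw [sub_eq_add_neg, Real.exp_add, Real.exp_log (by positivity)]
    _ ≤ Real.exp (Real.log n * -M) := by
        gcongr
        linarith [mul_le_mul_of_nonneg_left hbase_one hΛ]
    _ = (n : ℝ) ^ (-M) := (Real.rpow_def_of_pos hn' _).symm

theorem exists_sampleSize {N₀ : ℕ} (hN₀ : 0 < N₀) {s ε : ℝ} (hs : 0 < s) (hε : 0 < ε) :
    ∃ N : ℕ, N₀ ≤ N ∧ (N : ℝ) ≤ (1 / s ^ 2 + 1) * N₀ * max 1 (1 / ε ^ 2) ∧
      √((N₀ : ℝ) / N) ≤ s * min 1 ε := by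
  set Z := max 1 (1 / ε ^ 2)
  have hZ : 1 ≤ Z := le_max_left _ _
  have hmin : 1 / min 1 ε ^ 2 ≤ Z := by
    rcases min_choice 1 ε with h | h <;> rw [h]
    · simpa using hZ
    · exact le_max_right _ _
  have hpos : 0 < Z / s ^ 2 := by positivity
  have hceil : Z / s ^ 2 ≤ ⌈Z / s ^ 2⌉₊ := Nat.le_ceil _
  refine ⟨N₀ * ⌈Z / s ^ 2⌉₊, Nat.le_mul_of_pos_right _ (Nat.ceil_pos.2 hpos), ?_, ?_⟩
  · push_cast
    calc (N₀ * ⌈Z / s ^ 2⌉₊ : ℝ) ≤ N₀ * (Z / s ^ 2 + Z) := by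
          gcongr
          linarith [Nat.ceil_lt_add_one hpos.le]
      _ = (1 / s ^ 2 + 1) * N₀ * Z := by ring
  · refine Real.sqrt_le_iff.2 ⟨by positivity, ?_⟩
    push_cast
    rw [div_mul_cancel_left₀ (by positivity), inv_le_comm₀ (hpos.trans_le hceil) (by positivity)]
    calc ((s * min 1 ε) ^ 2)⁻¹ = 1 / min 1 ε ^ 2 / s ^ 2 := by
          rw [mul_pow]
          field_simp
      _ ≤ Z / s ^ 2 := by gcongr
      _ ≤ ⌈Z / s ^ 2⌉₊ := hceil

end SampleSize

section TwoStage

open Filter Topology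
open scoped Matrix.Norms.Frobenius

theorem exists_measurableSet_one_sub_le {Ω : Type*} [MeasurableSpace Ω] {μ : Measure Ω}
    [IsProbabilityMeasure μ] {B : Set Ω} {p : ℝ} (hB : μ.real B ≤ p) :
    ∃ A, MeasurableSet A ∧ 1 - p ≤ μ.real A ∧ ∀ ω ∈ A, ω ∉ B := by
  refine ⟨(toMeasurable μ B)ᶜ, (measurableSet_toMeasurable μ B).compl, ?_,
    fun ω hω hωB => hω (subset_toMeasurable μ B hωB)⟩
  rw [probReal_compl_eq_one_sub (measurableSet_toMeasurable μ B), measureReal_def,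
    measure_toMeasurable]
  exact sub_le_sub_left hB 1

variable {d q n : ℕ}

theorem exists_measureReal_lt_norm_sampleCov_sub_le_rpow {ν : Measure (E n)}
    [IsProbabilityMeasure ν] {C : Matrix (Fin n) (Fin n) ℝ} {c : ℝ} (hn : 0 < n) (hc : 0 < c)
    (hν : Integrable (fun z => Real.exp (c * ‖z‖ ^ 2)) ν)
    (hC : ∀ i j, ∫ z : E n, z i * z j ∂ν = C i j) :
    ∃ τ > 0, ∃ s > 0, ∀ M > 0, ∀ N : ℕ, 0 < N → √(sampleBase n M / N) ≤ s →
      ∀ (Ω : Type*) [MeasurableSpace Ω] (μ : Measure Ω) (y : Fin N → Ω → E n), iIndepFun y μ →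
        (∀ s, HasLaw (y s) ν μ) →
        μ.real {ω | τ * √(sampleBase n M / N) < ‖sampleCov (fun s => y s ω) - C‖} ≤
          (n : ℝ) ^ (-M) := by
  obtain ⟨U, hU, t₁, ht₁, htail⟩ := exists_measureReal_lt_norm_sampleCov_sub_le hc hν hC
  have hn' : (0 : ℝ) < n := by exact_mod_cast hn
  have hlog : 0 ≤ Real.log (2 * n ^ 2) := by
    exact_mod_cast Real.log_natCast_nonneg (2 * n ^ 2)
  set Λ := 1 + Real.log (2 * n ^ 2)
  have hΛ : 0 < Λ := by positivity
  refine ⟨n * √(U * Λ), by positivity, t₁ / √(U * Λ), by positivity,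
    fun M hM N hN hs Ω _ μ y hind hlaw => ?_⟩
  have hN' : (0 : ℝ) < N := by exact_mod_cast hN
  have hexponent : N * (√(U * Λ) * √(sampleBase n M / N)) ^ 2 / U = Λ * sampleBase n M := by
    rw [mul_pow, Real.sq_sqrt (by positivity), Real.sq_sqrt (by positivity)]
    field_simp
  rw [le_div_iff₀' (by positivity)] at hs
  have hbound := htail N _ (by positivity) hs Ω μ y hind hlaw
  rw [hexponent, ← mul_assoc] at hbound
  exact hbound.trans (two_mul_sq_mul_exp_sampleBase_le hn hM)

theorem exists_sampleSize_forall_norm_sampleCov_sub_add_le {ν : Measure (E n)}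
    [IsProbabilityMeasure ν] {C : Matrix (Fin n) (Fin n) ℝ} {c : ℝ} (hn : 0 < n) (hc : 0 < c)
    (hν : Integrable (fun z => Real.exp (c * ‖z‖ ^ 2)) ν)
    (hC : ∀ i j, ∫ z : E n, z i * z j ∂ν = C i j) {α₀ η : ℝ} (hα₀ : 0 ≤ α₀) (hη : 0 < η) :
    ∃ K > (0 : ℝ), ∀ M > (0 : ℝ), ∀ ε > (0 : ℝ), ∃ N : ℕ, sampleBase n M ≤ N ∧
      (N : ℝ) ≤ K * sampleBase n M * max 1 (1 / ε ^ 2) ∧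
      ∀ (Ω : Type*) [MeasurableSpace Ω] (μ : Measure Ω) (y : Fin N → Ω → E n), iIndepFun y μ →
        (∀ s, HasLaw (y s) ν μ) →
        ∃ A : Set Ω, MeasurableSet A ∧ 1 - (n : ℝ) ^ (-M) ≤ μ.real A ∧ ∀ ω ∈ A,
          ‖sampleCov (fun s => y s ω) - C‖ + α₀ * √(sampleBase n M / N) ≤ η * min 1 ε := by
  obtain ⟨τ, hτ, s₁, hs₁, htail⟩ :=
    exists_measureReal_lt_norm_sampleCov_sub_le_rpow hn hc hν hC
  obtain ⟨s, hs, hss₁, hsη⟩ : ∃ s > 0, s ≤ s₁ ∧ (τ + α₀) * s ≤ η :=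
    ⟨min s₁ (η / (τ + α₀)), by positivity, min_le_left _ _,
      (le_div_iff₀' (by positivity)).1 (min_le_right _ _)⟩
  refine ⟨1 / s ^ 2 + 1, by positivity, fun M hM ε hε => ?_⟩
  have hbase := sampleBase_pos (n := n) hM
  obtain ⟨N, hN, hNK, hσ⟩ := exists_sampleSize hbase hs hε
  refine ⟨N, hN, hNK, fun Ω _ μ y hind hlaw => ?_⟩
  have := hind.isProbabilityMeasure
  have hσs : √(sampleBase n M / N) ≤ s :=
    hσ.trans (mul_le_of_le_one_right hs.le (min_le_left _ _))
  obtain ⟨A, hA, hprob, hgood⟩ := exists_measurableSet_one_sub_le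
    (htail M hM N (hbase.trans_le hN) (hσs.trans hss₁) Ω μ y hind hlaw)
  refine ⟨A, hA, hprob, fun ω hω => ?_⟩
  calc ‖sampleCov (fun s => y s ω) - C‖ + α₀ * √(sampleBase n M / N)
      ≤ (τ + α₀) * √(sampleBase n M / N) := by
        rw [add_mul]
        gcongr
        exact not_lt.1 (hgood ω hω)
    _ ≤ (τ + α₀) * (s * min 1 ε) := by gcongr
    _ = (τ + α₀) * s * min 1 ε := by ring
    _ ≤ η * min 1 ε := by gcongr

theorem longVec_covMatrix (k : E d → E d → E q → ℝ) (x : Fin n → E d) (θ : Param q) :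
    longVec (covMatrix k x θ) = θ.snd • corrVec k x θ.fst := by
  ext p
  simp [longVec, covMatrix, corrVec]

variable {k : E d → E d → E q → ℝ} {x : Fin n → E d} {Θρ : Set (E q)} {θ : Param q} {i : Fin n}
  {a b : ℝ}

theorem exists_isStageTwo_of_norm_sub_add_le (hdiag : ∀ t ∈ Θρ, k (x i) (x i) t = 1)
    (hρ : θ.fst ∈ interior Θρ) (hv : 0 < θ.snd) (hC : (covMatrix k x θ).PosDef)
    (hid : IdentifiableAt k x Θρ θ.fst) (ha : 0 < a)
    (hP : (covMatrix k x θ)⁻¹ ∈ spectralBox n a b)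
    (hr : ContDiffAt ℝ 2 (corrVec k x) θ.fst)
    (hli : LinearIndependent ℝ (Fin.cons (corrVec k x θ.fst)
      (fun j : Fin q => fderiv ℝ (corrVec k x) θ.fst (EuclideanSpace.single j (1 : ℝ))) :
        Fin (q + 1) → LongVec n)) :
    ∃ L > 0, ∃ ρ > 0, ∃ m > 0, ∃ δ > 0, ∀ S α, 0 ≤ α → ‖S - covMatrix k x θ‖ + α ≤ ρ →
      (∃ P θhat, IsStageOne x a b α S P ∧ IsStageTwo k x Θρ (longVec P⁻¹) θhat) ∧
      ∀ P θhat, IsStageOne x a b α S P → IsStageTwo k x Θρ (longVec P⁻¹) θhat →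
        ‖θhat - θ‖ ≤ L * (‖S - covMatrix k x θ‖ + α) ∧
        StrongConvexOn (Metric.ball θhat.fst δ) m (stageTwoObj k x (longVec P⁻¹)) := by
  obtain ⟨L₁, hL₁, hone⟩ := exists_norm_longVec_inv_sub_le x hC ha hP
  obtain ⟨L₂, hL₂, m, hm, δ, hδ, htwo⟩ :=
    exists_eventually_isStageTwo hdiag hρ hv hid hr hli
  obtain ⟨r, hr, hball⟩ := Metric.nhds_basis_closedBall.eventually_iff.1 htwo
  simp only [longVec_covMatrix] at hone
  refine ⟨L₂ * L₁, by positivity, r / L₁, by positivity, m, hm, δ, hδ, fun S α hα hS => ?_⟩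
  rw [le_div_iff₀' hL₁] at hS
  have hnear := fun P hPS => hball (mem_closedBall_iff_norm.2 ((hone S α P hα hPS).trans hS))
  constructor
  · obtain ⟨P, hPS⟩ := exists_isStageOne x ha ⟨_, hP⟩ α S
    obtain ⟨θhat, hθhat⟩ := (hnear P hPS).1
    exact ⟨P, θhat, hPS, hθhat⟩
  · intro P θhat hPS hθhat
    obtain ⟨herr, hconv⟩ := (hnear P hPS).2 θhat hθhat
    refine ⟨herr.trans ?_, hconv⟩
    rw [mul_assoc]
    gcongr
    exact hone S α P hα hPS

end TwoStage

end SPS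

theorem mainTheorem1_general {d q n : ℕ} {k : SPS.E d → SPS.E d → SPS.E q → ℝ}
    {Θρ : Set (SPS.E q)} {x : Fin n → SPS.E d} {i : Fin n}
    (hdiag : ∀ t ∈ Θρ, k (x i) (x i) t = 1) {θ : SPS.Param q} (hρ : θ.fst ∈ interior Θρ)
    (hv : 0 < θ.snd) (hC : (SPS.covMatrix k x θ).PosDef)
    (hid : SPS.IdentifiableAt k x Θρ θ.fst) {a b : ℝ} (ha : 0 < a)
    (hP : (SPS.covMatrix k x θ)⁻¹ ∈ SPS.spectralBox n a b)
    (hr : ContDiffAt ℝ 2 (SPS.corrVec k x) θ.fst)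
    (hli : LinearIndependent ℝ (Fin.cons (SPS.corrVec k x θ.fst)
      (fun j : Fin q => fderiv ℝ (SPS.corrVec k x) θ.fst (EuclideanSpace.single j (1 : ℝ))) :
        Fin (q + 1) → SPS.LongVec n))
    {ν : Measure (SPS.E n)} [IsProbabilityMeasure ν] {c : ℝ} (hc : 0 < c)
    (hν : Integrable (fun z => Real.exp (c * ‖z‖ ^ 2)) ν)
    (hcov : ∀ j l, ∫ z : SPS.E n, z j * z l ∂ν = SPS.covMatrix k x θ j l)
    {α₀ : ℝ} (hα₀ : 0 ≤ α₀) :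
    ∃ K > (0 : ℝ), ∃ m > (0 : ℝ), ∃ δ > (0 : ℝ), ∀ M > (0 : ℝ), ∀ ε > (0 : ℝ),
      ∃ N : ℕ, SPS.sampleBase n M ≤ N ∧
        (N : ℝ) ≤ K * SPS.sampleBase n M * max 1 (1 / ε ^ 2) ∧
        ∀ α : ℝ, α = α₀ * √((SPS.sampleBase n M : ℝ) / N) →
        ∀ (Ω : Type*) [MeasurableSpace Ω] (μ : Measure Ω) (y : Fin N → Ω → SPS.E n),
          iIndepFun y μ → (∀ s, HasLaw (y s) ν μ) →
          ∃ A : Set Ω, MeasurableSet A ∧ 1 - (n : ℝ) ^ (-M) ≤ μ.real A ∧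
            ∀ ω ∈ A,
              (∃ (P : Matrix (Fin n) (Fin n) ℝ) (θhat : SPS.Param q),
                SPS.IsStageOne x a b α (SPS.sampleCov fun s => y s ω) P ∧
                SPS.IsStageTwo k x Θρ (SPS.longVec P⁻¹) θhat) ∧
              ∀ (P : Matrix (Fin n) (Fin n) ℝ) (θhat : SPS.Param q),
                SPS.IsStageOne x a b α (SPS.sampleCov fun s => y s ω) P →
                SPS.IsStageTwo k x Θρ (SPS.longVec P⁻¹) θhat →
                ‖θhat - θ‖ ≤ ε ∧
                StrongConvexOn (Metric.ball θhat.fst δ) m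
                  (SPS.stageTwoObj k x (SPS.longVec P⁻¹)) := by
  obtain ⟨L, hL, η, hη, m, hm, δ, hδ, hstages⟩ :=
    SPS.exists_isStageTwo_of_norm_sub_add_le hdiag hρ hv hC hid ha hP hr hli
  obtain ⟨K, hK, hsample⟩ := SPS.exists_sampleSize_forall_norm_sampleCov_sub_add_le i.pos hc hν
    hcov hα₀ (show 0 < min η (1 / L) by positivity)
  refine ⟨K, hK, m, hm, δ, hδ, fun M hM ε hε => ?_⟩
  obtain ⟨N, hN, hNK, hA⟩ := hsample M hM ε hε
  refine ⟨N, hN, hNK, fun α hα Ω _ μ y hind hlaw => ?_⟩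
  obtain ⟨A, hAmeas, hprob, hgood⟩ := hA Ω μ y hind hlaw
  refine ⟨A, hAmeas, hprob, fun ω hω => ?_⟩
  have hnear := hα ▸ hgood ω hω
  obtain ⟨hexist, hall⟩ := hstages _ α (by rw [hα]; positivity) (hnear.trans
    ((mul_le_of_le_one_right (by positivity) (min_le_left _ _)).trans (min_le_left _ _)))
  refine ⟨hexist, fun P θhat hPS hθhat => (hall P θhat hPS hθhat).imp_left fun herr => ?_⟩
  calc ‖θhat - θ‖ ≤ L * (min η (1 / L) * min 1 ε) := herr.trans (by gcongr)
    _ ≤ L * (1 / L * ε) := by gcongr <;> exact min_le_right _ _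
    _ = ε := by field_simp

theorem mainTheorem1 {d q n : ℕ} (hn : 2 ≤ n)
    -- the parametric correlation function, the parameter set and the distinct locations
    (X : Set (SPS.E d)) (k : SPS.E d → SPS.E d → SPS.E q → ℝ) (Θρ : Set (SPS.E q))
    (hk : ∀ t ∈ Θρ, SPS.IsCorrelationFunction X fun z z' => k z z' t)
    (x : Fin n → SPS.E d) (hxX : ∀ i, x i ∈ X) (hx : Function.Injective x)
    -- the true parameters
    (θ : SPS.Param q) (hρ : θ.fst ∈ interior Θρ) (hv : 0 < θ.snd)
    (hC : (SPS.covMatrix k x θ).PosDef)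
    (hid : SPS.IdentifiableAt k x Θρ θ.fst)
    -- the bounds `a I ⪯ P* ⪯ b I` on the true precision matrix
    (a b : ℝ) (ha : 0 < a) (hP : (SPS.covMatrix k x θ)⁻¹ ∈ SPS.spectralBox n a b)
    -- smoothness and linear independence
    (hr : ContDiffOn ℝ 2 (SPS.corrVec k x) (interior Θρ))
    (hli : LinearIndependent ℝ
      (Fin.cons (SPS.corrVec k x θ.fst)
        (fun j : Fin q =>
          fderiv ℝ (SPS.corrVec k x) θ.fst (EuclideanSpace.single j (1 : ℝ))) :
        Fin (q + 1) → SPS.LongVec n)) :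
    ∃ K > (0 : ℝ), ∃ m > (0 : ℝ), ∃ δ > (0 : ℝ), ∀ M > (0 : ℝ), ∀ ε > (0 : ℝ),
      ∃ N : ℕ, SPS.sampleBase n M ≤ N ∧
        (N : ℝ) ≤ K * SPS.sampleBase n M * max 1 (1 / ε ^ 2) ∧
        ∀ α : ℝ, α = 40 * θ.snd * √((SPS.sampleBase n M : ℝ) / N) →
        ∀ (Ω : Type*) [MeasurableSpace Ω] (μ : MeasureTheory.Measure Ω)
          [MeasureTheory.IsProbabilityMeasure μ] (y : Fin N → Ω → SPS.E n),
          SPS.IsGRFSample k x θ μ y →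
          ∃ A : Set Ω, MeasurableSet A ∧ 1 - (n : ℝ) ^ (-M) ≤ μ.real A ∧
            ∀ ω ∈ A,
              -- the two-stage estimate exists, and each such estimate is accurate
              (∃ (P : Matrix (Fin n) (Fin n) ℝ) (θhat : SPS.Param q),
                SPS.IsStageOne x a b α (SPS.sampleCov fun s => y s ω) P ∧
                SPS.IsStageTwo k x Θρ (SPS.longVec P⁻¹) θhat) ∧
              ∀ (P : Matrix (Fin n) (Fin n) ℝ) (θhat : SPS.Param q),
                SPS.IsStageOne x a b α (SPS.sampleCov fun s => y s ω) P →
                SPS.IsStageTwo k x Θρ (SPS.longVec P⁻¹) θhat →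
                ‖θhat - θ‖ ≤ ε ∧
                StrongConvexOn (Metric.ball θhat.fst δ) m
                  (SPS.stageTwoObj k x (SPS.longVec P⁻¹)) := by
  obtain ⟨c, hc, hint⟩ := IsGaussian.exists_integrable_exp_sq
    (multivariateGaussian 0 (SPS.covMatrix k x θ))
  obtain ⟨K, hK, m, hm, δ, hδ, hmain⟩ := mainTheorem1_general (i := ⟨0, by omega⟩)
    (fun t ht => (hk t ht).1 _ (hxX _)) hρ hv hC hid ha hP
    (hr.contDiffAt (isOpen_interior.mem_nhds hρ)) hli hc hint
    (SPS.integral_eval_mul_eval_multivariateGaussian hC.posSemidef)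
    (show 0 ≤ 40 * θ.snd by positivity)
  refine ⟨K, hK, m, hm, δ, hδ, fun M hM ε hε => ?_⟩
  obtain ⟨N, hN, hNK, hest⟩ := hmain M hM ε hε
  exact ⟨N, hN, hNK, fun α hα Ω _ μ _ y hy => hest α hα Ω μ y hy.1 hy.2⟩
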